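/- **Proposition 3.1.** Let $a,b,\varepsilon>0$ and $0<\theta<\pi/2$. For $n\ge 1$ put $$a_{n,i}=\frac{a+(i-1)\varepsilon/n}{n},\qquad b_n=\frac bn,\qquad \varepsilon_n=\frac{\varepsilon}{n^2},\qquad d_n^{\ell}=\frac{\varepsilon_n}{2\sin\theta},$$ and consider only $n$ so large that $d_n^\ell\cos\theta<b_n$. *The surfaces.* For $1\le i\le n$ let $H_{n,i}:[0,b_n]\to\mathbb R$ be the continuous piecewise affine function that equals $a_{n,i}/2$ on $[0,x_-]$, has slope $\tan\theta$ on $[x_-,x_+]$ and equals $(a_{n,i}+\varepsilon_n)/2$ on $[x_+,b_n]$, where $x_\pm=\tfrac12(b_n\pm d_n^\ell\cos\theta)$. For $1\le i,j\le n$ the block $\tilde{\mathcal M}_n(i,j)$ is obtained from the lower hexagon $\{(X,Y):0\le X\le b_n,\ 0\le Y\le H_{n,i}(X)\}$ and the upper hexagon $\{(X,Y):0\le X\le b_n,\ -H_{n,i}(X)\le Y\le 0\}$ by identifying the point $(X,H_{n,i}(X))$ of the lower one with the point $(X,-H_{n,i}(X))$ of the upper one for all $X$. The surface $\tilde{\mathcal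 M}_n$ is obtained from the $n^2$ blocks by gluing isometrically the top side ($Y=0$ in the upper hexagon) of $\tilde{\mathcal M}_n(i,j)$ to the bottom side ($Y=0$ in the lower hexagon) of $\tilde{\mathcal M}_n(i,j+1)$, by $(X,0)\sim(X,0)$, and the right side of $\tilde{\mathcal M}_n(i,j)$ to the left side of $\tilde{\mathcal M}_n(i+1,j)$, by $(b_n,Y)\sim(0,Y)$ in the lower and in the upper hexagons. Let $d_n$ be the intrinsic distance of $\tilde{\mathcal M}_n$ (infimum of Euclidean lengths of curves), and let $\mathfrak g_n=dX^2+dY^2$, with the orientation of $(X,Y)$, on $\mathcal M_n$, which is $\tilde{\mathcal M}_n$ without the segments over $[x_-,x_+]$ along which the two hexagons of a block are glued. *The limit.* Let $R_0=ab/\varepsilon$, $R_1=R_0+b$, and let $\mathcal N=\{(r,\varphi)\in[R_0,R_1]\times[0,\varepsilon/b]\}$ be the sector of angle $\varepsilon/b$ of the annulus with radii $R_0,R_1$, in polar coordinates, with the Euclidean metric $\mathfrak g=dr^2+r^2d\varphi^2$, its volume $d\mathrm{Vol}_{\mathfrak g}=r\,dr\,d\varphi$, the orientation of $(r,\varphi)$,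 and its intrinsic distance $d$. *The maps.* Let $\Delta\varphi_n=\varepsilon_n/b_n$, $D=\Delta\varphi_n/(2\tan\theta)$, and, for real $s$, $r_s=R_0+(s-1)b_n$ and $\varphi_s=(s-1)\Delta\varphi_n$. For $r\in[r_i,r_{i+1}]$ let $$h_{n,i}(r)=\begin{cases} r_i & r\le r_{i+1/2-D/2},\\ r_i+\frac1D\,(r-r_{i+1/2-D/2}) & r_{i+1/2-D/2}\le r\le r_{i+1/2+D/2},\\ r_{i+1}& r\ge r_{i+1/2+D/2}.\end{cases}$$ The map $F_n:\mathcal N\to\tilde{\mathcal M}_n$ sends $(r,\varphi)\in[r_i,r_{i+1}]\times[\varphi_j,\varphi_{j+1/2}]$ to the point $\big(r-r_i,\ (\varphi-\varphi_j)\,h_{n,i}(r)\big)$ of the lower hexagon of $\tilde{\mathcal M}_n(i,j)$, and $(r,\varphi)\in[r_i,r_{i+1}]\times[\varphi_{j+1/2},\varphi_{j+1}]$ to the point $\big(r-r_i,\ (\varphi-\varphi_{j+1})\,h_{n,i}(r)\big)$ of its upper hexagon. Its differential $dF_n$ is defined almost everywhere. Then, as $n\to\infty$: 1. $\operatorname{dis}F_n=\sup_{x,y\in\mathcal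 N}\big|d(x,y)-d_n(F_n(x),F_n(y))\big|\to 0$. 2. For every $p\in[1,\infty)$, $$\int_{\mathcal N}\operatorname{dist}^p\big(dF_n,SO(\mathfrak g,\mathfrak g_n)\big)\,d\mathrm{Vol}_{\mathfrak g}\to 0,$$ where, at almost every $x\in\mathcal N$, $SO(\mathfrak g,\mathfrak g_n)$ is the set of metric- and orientation-preserving linear maps $T_x\mathcal N\to T_{F_n(x)}\mathcal M_n$, and $\operatorname{dist}$ is taken in the operator norm with respect to $\mathfrak g$ and $\mathfrak g_n$. -/

import Mathlib

open Set Filter Topology MeasureTheory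

noncomputable section

namespace EdgeDislocation

/-! ### Curves and lengths -/

/-- The Euclidean norm of a vector `v` of the plane (`ℝ × ℝ` itself carries the sup norm; only its
topology, its linear structure and its Lebesgue measure are used below): the metric
`dX² + dY²`. -/
def flatNorm (v : ℝ × ℝ) : ℝ := √(v.1 ^ 2 + v.2 ^ 2)

/-- The norm of a tangent vector `v = (v_r, v_φ)` at `x = (r, φ)` in the metric `dr² + r² dφ²`. -/
def polarNorm (x v : ℝ × ℝ) : ℝ := √(v.1 ^ 2 + x.1 ^ 2 * v.2 ^ 2)

/-- There is a `C¹` arc inside `S` from `x` to `y` whose length is `L`, where tangent vectors are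
measured by `nrm`. -/
def IsArc (S : Set (ℝ × ℝ)) (nrm : ℝ × ℝ → ℝ × ℝ → ℝ) (x y : ℝ × ℝ) (L : ℝ) : Prop :=
  ∃ (γ : ℝ → ℝ × ℝ) (s t : ℝ), s ≤ t ∧ ContDiff ℝ 1 γ ∧ (∀ τ ∈ Icc s t, γ τ ∈ S) ∧
    γ s = x ∧ γ t = y ∧ L = ∫ τ in s..t, nrm (γ τ) (deriv γ τ)

/-- `Chain arc p q L`: there is a finite concatenation of arcs from `p` to `q` of total length
`L`. -/
inductive Chain {α : Type} (arc : α → α → ℝ → Prop) : α → α → ℝ → Prop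
  | nil (p : α) : Chain arc p p 0
  | cons {p q r : α} {l L : ℝ} (h : arc p q l) (t : Chain arc q r L) : Chain arc p r (l + L)

/-- The infimum of the lengths of all finite concatenations of arcs from `p` to `q`. -/
def pathDist {α : Type} (arc : α → α → ℝ → Prop) (p q : α) : ℝ := sInf {L | Chain arc p q L}

/-! ### The building block -/

/-- Abscissa of the singular point `p₋` in a block of width `β` and dislocation magnitude `δ`.
The dislocation line has length `d = δ / (2 sin θ)`, and it is centred in the block. -/
def xMinus (β θ δ : ℝ) : ℝ := (β - δ / (2 * Real.sin θ) * Real.cos θ) / 2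

/-- Abscissa of the singular point `p₊`. -/
def xPlus (β θ δ : ℝ) : ℝ := (β + δ / (2 * Real.sin θ) * Real.cos θ) / 2

/-- The height over the abscissa `X` of the broken line `E p₋ p₊ F`, measured from the edge `BC`:
it is `α/2` on `E p₋`, it has slope `tan θ` on `p₋ p₊` and it is `(α + δ)/2` on `p₊ F`. -/
def height (α β θ δ X : ℝ) : ℝ :=
  if X ≤ xMinus β θ δ then α / 2
  else if X ≤ xPlus β θ δ then α / 2 + (X - xMinus β θ δ) * Real.tan θ
  else (α + δ) / 2

/-- The Euclidean hexagons `B C F p₊ p₋ E` (lower, `up = false`, with the edge `BC` on the line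
`Y = 0`) and `A D F p₊ p₋ E` (upper, `up = true`, with the edge `AD` on the line `Y = 0`) that
form the block with sides `α, β, β, α + δ`. -/
def hexagon (α β θ δ : ℝ) (up : Bool) : Set (ℝ × ℝ) :=
  {x | 0 ≤ x.1 ∧ x.1 ≤ β ∧
    if up then -height α β θ δ x.1 ≤ x.2 ∧ x.2 ≤ 0 else 0 ≤ x.2 ∧ x.2 ≤ height α β θ δ x.1}

/-! ### The surfaces with `n²` dislocations -/

/-- The parameters `a, b, ε, θ` of the construction. -/
structure Params where
  a : ℝ
  b : ℝ
  ε : ℝ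
  θ : ℝ
  a_pos : 0 < a
  b_pos : 0 < b
  ε_pos : 0 < ε
  θ_pos : 0 < θ
  θ_lt : θ < Real.pi / 2

namespace Params

variable (P : Params) (n : ℕ+)

/-- Left side of the blocks of the `i`-th column; columns are numbered from `0` to `n - 1`. -/
def aCell (i : ℕ) : ℝ := (P.a + i * P.ε / (n : ℕ)) / (n : ℕ)

/-- Width of every block. -/
def bCell : ℝ := P.b / (n : ℕ)

/-- Dislocation magnitude of every block. -/
def εCell : ℝ := P.ε / ((n : ℕ) : ℝ) ^ 2

end Params

/-- Labels of the `2 n²` hexagons: column, row, and whether it is the upper one of its block. -/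
abbrev Label (n : ℕ+) : Type := Fin n × Fin n × Bool

namespace Params

variable (P : Params) (n : ℕ+)

/-- The hexagon with label `h`. -/
def hex (h : Label n) : Set (ℝ × ℝ) :=
  hexagon (P.aCell n h.1) (P.bCell n) P.θ (P.εCell n) h.2.2

/-- The disjoint union of all hexagons. -/
abbrev Pieces : Type := Σ h : Label n, P.hex n h

/-- The identifications of boundary points of the hexagons. -/
inductive Glue : P.Pieces n → P.Pieces n → Prop
  /-- Inside the block `(i, j)`: the two hexagons are glued along `E p₋ p₊ F`. -/
  | mid (i j : Fin n) (X Y Y' : ℝ)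
      (hY : Y = height (P.aCell n i) (P.bCell n) P.θ (P.εCell n) X) (hY' : Y' = -Y)
      (h : (X, Y) ∈ P.hex n (i, j, false)) (h' : (X, Y') ∈ P.hex n (i, j, true)) :
      Glue ⟨(i, j, false), ⟨(X, Y), h⟩⟩ ⟨(i, j, true), ⟨(X, Y'), h'⟩⟩
  /-- The top side of the block `(i, j)` is glued to the bottom side of the block `(i, j + 1)`. -/
  | vert (i j j' : Fin n) (hj : (j' : ℕ) = j + 1) (X : ℝ)
      (h : (X, 0) ∈ P.hex n (i, j, true)) (h' : (X, 0) ∈ P.hex n (i, j', false)) :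
      Glue ⟨(i, j, true), ⟨(X, 0), h⟩⟩ ⟨(i, j', false), ⟨(X, 0), h'⟩⟩
  /-- The right side of the block `(i, j)` is glued to the left side of the block `(i + 1, j)`. -/
  | horiz (i i' j : Fin n) (hi : (i' : ℕ) = i + 1) (up : Bool) (Y : ℝ)
      (h : (P.bCell n, Y) ∈ P.hex n (i, j, up)) (h' : (0, Y) ∈ P.hex n (i', j, up)) :
      Glue ⟨(i, j, up), ⟨(P.bCell n, Y), h⟩⟩ ⟨(i', j, up), ⟨(0, Y), h'⟩⟩

/-- The surface with `n²` edge-dislocations: the quotient of the disjoint union of the hexagons by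
the equivalence relation generated by the identifications. -/
def Surface : Type := Quot (P.Glue n)

/-- An arc of the surface that runs inside one hexagon. -/
def surfaceArc (p q : P.Surface n) (L : ℝ) : Prop :=
  ∃ (h : Label n) (x y : P.hex n h), Quot.mk _ ⟨h, x⟩ = p ∧ Quot.mk _ ⟨h, y⟩ = q ∧
    IsArc (P.hex n h) (fun _ v => flatNorm v) x y L

/-- The intrinsic distance `d_n` of the surface. -/
def surfaceDist (p q : P.Surface n) : ℝ := pathDist (P.surfaceArc n) p q

/-! ### The limit sector -/

/-- Inner radius. -/
def R₀ : ℝ := P.a * P.b / P.ε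

/-- Outer radius. -/
def R₁ : ℝ := P.R₀ + P.b

/-- The sector in polar coordinates `(r, φ)`. -/
def sector : Set (ℝ × ℝ) := Icc P.R₀ P.R₁ ×ˢ Icc 0 (P.ε / P.b)

/-- The intrinsic distance `d` of the sector, for the metric `dr² + r² dφ²`: the infimum of the
lengths of piecewise `C¹` curves in the sector. -/
def sectorDist (x y : P.sector) : ℝ :=
  pathDist (fun p q : P.sector => IsArc P.sector polarNorm p q) x y

/-- The Riemannian volume `r dr dφ` of the sector. -/
def sectorVol : Measure (ℝ × ℝ) :=
  (volume.restrict P.sector).withDensity fun x => ENNReal.ofReal x.1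

/-! ### The maps `F_n` -/

/-- `r_s = R₀ + s ΔR_n` with `ΔR_n = b_n`, also for non-integral `s`. -/
def rad (s : ℝ) : ℝ := P.R₀ + s * P.bCell n

/-- `Δφ_n = ε_n / b_n`. -/
def dφ : ℝ := P.εCell n / P.bCell n

/-- `φ_s = s Δφ_n`, also for non-integral `s`. -/
def ang (s : ℝ) : ℝ := s * P.dφ n

/-- The relative width of the middle zone of a cell. -/
def D : ℝ := P.dφ n / (2 * Real.tan P.θ)

/-- The factor that multiplies the angle in the second component of `F_n`. -/
def factor (i : ℕ) (r : ℝ) : ℝ :=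
  if r ≤ P.rad n (i + 1 / 2 - P.D n / 2) then P.rad n i
  else if r ≤ P.rad n (i + 1 / 2 + P.D n / 2) then
    P.rad n i + 1 / P.D n * (r - P.rad n (i + 1 / 2 - P.D n / 2))
  else P.rad n (i + 1)

/-- The expression of `F_n` on the half-cell with label `h`, in the polar coordinates `(r, φ)` of
the sector and the Euclidean coordinates `(X, Y)` of the hexagon with the same label. -/
def chartF (h : Label n) (x : ℝ × ℝ) : ℝ × ℝ :=
  (x.1 - P.rad n (h.1 : ℕ),
    (x.2 - if h.2.2 then P.ang n ((h.2.1 : ℕ) + 1) else P.ang n (h.2.1 : ℕ)) *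
      P.factor n h.1 x.1)

/-- The integer part of `t`, cut off at `n - 1`. -/
def idx (n : ℕ+) (t : ℝ) : Fin n :=
  ⟨min ⌊t⌋₊ (n - 1), lt_of_le_of_lt (min_le_right _ _) (Nat.sub_lt n.pos one_pos)⟩

/-- The label of a closed half-cell `[r_i, r_{i+1}] × [φ_j, φ_{j+1/2}]` (lower) or
`[r_i, r_{i+1}] × [φ_{j+1/2}, φ_{j+1}]` (upper) that contains `x`.  Points common to several
half-cells get one of the labels; the images in the surface agree. -/
def label (x : ℝ × ℝ) : Label n :=
  let j := idx n (x.2 / P.dφ n)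
  (idx n ((x.1 - P.R₀) / P.bCell n), j, decide (P.ang n ((j : ℕ) + 1 / 2) < x.2))

section Membership

variable {P n}

theorem n_pos (n : ℕ+) : (0 : ℝ) < (n : ℕ) := by exact_mod_cast n.pos

theorem bCell_pos : 0 < P.bCell n := div_pos P.b_pos (n_pos n)

theorem dφ_pos : 0 < P.dφ n :=
  div_pos (div_pos P.ε_pos (pow_pos (n_pos n) 2)) bCell_pos

theorem idx_bounds {t : ℝ} (h0 : 0 ≤ t) (h1 : t ≤ (n : ℕ)) :
    ((idx n t : ℕ) : ℝ) ≤ t ∧ t ≤ (idx n t : ℕ) + 1 := by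
  have hn : 1 ≤ (n : ℕ) := n.pos
  have e : ((idx n t : Fin n) : ℕ) = min ⌊t⌋₊ ((n : ℕ) - 1) := rfl
  rw [e]
  rcases le_total ⌊t⌋₊ ((n : ℕ) - 1) with h | h
  · rw [min_eq_left h]
    exact ⟨Nat.floor_le h0, (Nat.lt_floor_add_one t).le⟩
  · rw [min_eq_right h]
    refine ⟨(Nat.cast_le.2 h).trans (Nat.floor_le h0), ?_⟩
    rw [Nat.cast_sub hn]
    simpa using h1

/-- The broken line `E p₋ p₊ F` is the image of the middle angle of the cell. -/
theorem factor_eq (i : ℕ) (r : ℝ) :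
    P.dφ n / 2 * P.factor n i r =
      height (P.aCell n i) (P.bCell n) P.θ (P.εCell n) (r - P.rad n i) := by
  have hs : 0 < Real.sin P.θ :=
    Real.sin_pos_of_pos_of_lt_pi P.θ_pos (by linarith [P.θ_lt, Real.pi_pos])
  have hc : 0 < Real.cos P.θ :=
    Real.cos_pos_of_mem_Ioo ⟨by linarith [P.θ_pos, Real.pi_pos], P.θ_lt⟩
  have ht : Real.tan P.θ = Real.sin P.θ / Real.cos P.θ := Real.tan_eq_sin_div_cos _
  have hb := bCell_pos (P := P) (n := n)
  have hn := n_pos n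
  have hε := P.ε_pos
  have hbb := P.b_pos
  have e1 : P.rad n (i + 1 / 2 - P.D n / 2) =
      P.rad n i + xMinus (P.bCell n) P.θ (P.εCell n) := by
    simp only [rad, D, dφ, xMinus, ht]
    field_simp
    ring
  have e2 : P.rad n (i + 1 / 2 + P.D n / 2) =
      P.rad n i + xPlus (P.bCell n) P.θ (P.εCell n) := by
    simp only [rad, D, dφ, xPlus, ht]
    field_simp
    ring
  have e3 : P.dφ n / 2 * P.rad n i = P.aCell n i / 2 := by
    simp only [rad, dφ, aCell, R₀, bCell, εCell]
    field_simp
  have e4 : P.dφ n / 2 * P.rad n (i + 1) = (P.aCell n i + P.εCell n) / 2 := by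
    simp only [rad, dφ, aCell, R₀, bCell, εCell]
    field_simp
    ring
  have e5 : P.dφ n / 2 * (1 / P.D n) = Real.tan P.θ := by
    have := dφ_pos (P := P) (n := n)
    simp only [D, ht]
    field_simp
  unfold factor height
  rw [e1, e2]
  by_cases h1 : r ≤ P.rad n i + xMinus (P.bCell n) P.θ (P.εCell n)
  · rw [if_pos h1, if_pos (by linarith), e3]
  · have h1' : ¬ r - P.rad n i ≤ xMinus (P.bCell n) P.θ (P.εCell n) :=
      fun h => h1 (by linarith)
    rw [if_neg h1, if_neg h1']
    by_cases h2 : r ≤ P.rad n i + xPlus (P.bCell n) P.θ (P.εCell n)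
    · rw [if_pos h2, if_pos (by linarith), mul_add, e3, ← mul_assoc, e5]
      ring
    · have h2' : ¬ r - P.rad n i ≤ xPlus (P.bCell n) P.θ (P.εCell n) :=
        fun h => h2 (by linarith)
      rw [if_neg h2, if_neg h2', e4]

theorem factor_nonneg (i : ℕ) (r : ℝ) : 0 ≤ P.factor n i r := by
  have hb := bCell_pos (P := P) (n := n)
  have hR : 0 < P.R₀ := div_pos (mul_pos P.a_pos P.b_pos) P.ε_pos
  have hD : 0 < P.D n :=
    div_pos dφ_pos (mul_pos two_pos (Real.tan_pos_of_pos_of_lt_pi_div_two P.θ_pos P.θ_lt))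
  have hr : 0 ≤ P.rad n i := by unfold rad; positivity
  unfold factor
  split_ifs with h1 h2
  · exact hr
  · push Not at h1
    have : 0 ≤ 1 / P.D n * (r - P.rad n (i + 1 / 2 - P.D n / 2)) :=
      mul_nonneg (by positivity) (by linarith)
    linarith
  · unfold rad; positivity

end Membership

/-- `F_n` maps a half-cell into the hexagon with the same label. -/
theorem chartF_mem {x : ℝ × ℝ} (hx : x ∈ P.sector) :
    P.chartF n (P.label n x) x ∈ P.hex n (P.label n x) := by
  obtain ⟨⟨h1, h2⟩, h3, h4⟩ := hx
  have hb := bCell_pos (P := P) (n := n)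
  have hd := dφ_pos (P := P) (n := n)
  have hn := n_pos n
  have hbb := P.b_pos
  have hi := idx_bounds (n := n) (t := (x.1 - P.R₀) / P.bCell n)
    (div_nonneg (by linarith) hb.le) (by
      rw [div_le_iff₀ hb]
      have : ((n : ℕ) : ℝ) * P.bCell n = P.b := by simp only [bCell]; field_simp
      rw [this]; unfold R₁ at h2; linarith)
  have hj := idx_bounds (n := n) (t := x.2 / P.dφ n) (div_nonneg h3 hd.le) (by
      rw [div_le_iff₀ hd]
      have : ((n : ℕ) : ℝ) * P.dφ n = P.ε / P.b := by
        simp only [dφ, bCell, εCell]; field_simp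
      rw [this]; exact h4)
  rw [le_div_iff₀ hb, div_le_iff₀ hb] at hi
  rw [le_div_iff₀ hd, div_le_iff₀ hd] at hj
  have hf := factor_nonneg (P := P) (n := n) (idx n ((x.1 - P.R₀) / P.bCell n)) x.1
  have hH := factor_eq (P := P) (n := n) (idx n ((x.1 - P.R₀) / P.bCell n)) x.1
  have e1 : (P.label n x).1 = idx n ((x.1 - P.R₀) / P.bCell n) := rfl
  have e2 : (P.label n x).2.1 = idx n (x.2 / P.dφ n) := rfl
  have e3 : (P.label n x).2.2 =
      decide (P.ang n ((idx n (x.2 / P.dφ n) : ℕ) + 1 / 2) < x.2) := rfl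
  simp only [hex, hexagon, chartF, Set.mem_ofPred_eq, e1, e2, e3]
  rw [← hH]
  generalize idx n ((x.1 - P.R₀) / P.bCell n) = i at *
  generalize idx n (x.2 / P.dφ n) = j at *
  refine ⟨by unfold rad; linarith, by unfold rad; linarith, ?_⟩
  by_cases h : P.ang n ((j : ℕ) + 1 / 2) < x.2
  · simp only [h, decide_true, if_true]
    unfold ang at h ⊢
    constructor
    · nlinarith
    · nlinarith
  · simp only [h, decide_false, Bool.false_eq_true, if_false]
    unfold ang at h ⊢
    push Not at h
    constructor
    · exact mul_nonneg (by linarith) hf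
    · exact mul_le_mul_of_nonneg_right (by linarith) hf

/-- The map `F_n` from the sector to the surface. -/
def F (x : P.sector) : P.Surface n :=
  Quot.mk _ ⟨P.label n x, ⟨P.chartF n (P.label n x) x, P.chartF_mem n x.2⟩⟩

/-- The distortion of `F_n`. -/
def distortion : ENNReal :=
  ⨆ (x : P.sector) (y : P.sector),
    ENNReal.ofReal |P.sectorDist x y - P.surfaceDist n (P.F n x) (P.F n y)|

/-- The differential of `F_n` at `x`, in the coordinates `(r, φ)` and `(X, Y)`.  It is meaningful
off a null set, namely inside the half-cells and off the arcs `r = r_{i + 1/2 ± D/2}`. -/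
def dF (x : ℝ × ℝ) : ℝ × ℝ →L[ℝ] ℝ × ℝ := fderiv ℝ (P.chartF n (P.label n x)) x

end Params

/-- The linear maps, from the tangent plane at `x` with `dr² + r² dφ²` to the plane with
`dX² + dY²`, that preserve the metric and the orientation. -/
def SO (x : ℝ × ℝ) : Set (ℝ × ℝ →L[ℝ] ℝ × ℝ) :=
  {Q | (∀ v, flatNorm (Q v) = polarNorm x v) ∧ 0 < Q.det}

/-- The operator norm of a linear map from the tangent plane at `x` with `dr² + r² dφ²` to the
plane with `dX² + dY²`. -/
def opNorm (x : ℝ × ℝ) (A : ℝ × ℝ →L[ℝ] ℝ × ℝ) : ℝ :=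
  sSup {c | ∃ v, v ≠ 0 ∧ c = flatNorm (A v) / polarNorm x v}

/-- The distance of `A` from the set of metric- and orientation-preserving maps. -/
def distSO (x : ℝ × ℝ) (A : ℝ × ℝ →L[ℝ] ℝ × ℝ) : ℝ :=
  sInf {c | ∃ Q ∈ SO x, c = opNorm x (A - Q)}

end EdgeDislocation

end

noncomputable section

namespace EdgeDislocation

/-! ### Norms -/

/-! The maps `F_n` are nearly isometric except in the middle zone of each cell. There `factor` has
slope `1 / D`, and multiplied by half the angle of a cell this is a shear of size `tan θ`, which
does not tend to zero. The relative width `D` of that zone does tend to zero, so the bad set has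
vanishing volume, and the differential is close to `SO` in every `L^p`. Distances need more, since
curves could run inside the bad set; each of the two inequalities is obtained by replacing `F_n` or
its inverse by a uniformly close map whose Lipschitz constant tends to 1.

Surface to sector: `G` divides the ordinate by `slopeRad`, a ramp of slope 2 instead of `1 / D`, and
truncates at the middle angle. The ramp stays below `factor`, so the broken line is sent to the
middle angle from both sides and `G` respects the gluing; its shear is only of order `dφ`. This
gives `sectorDist_le_surfaceDist`.

Sector to surface: `stretch` lets a zone of relative width `√D` be mapped onto the bad zone of width
`D`. Its slope `√D` turns the shear into `√D tan θ`, while elsewhere it costs only the factor `1 +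
√D`. Curves are transported by cutting them into pieces whose end points share a closed subcell,
which gives `surfaceDist_le_sectorDist`.

Both auxiliary maps move points by at most the size of a cell, and the diameters stay bounded, so
the multiplicative errors become additive and vanish. The differential is compared with the single
isometry `polarFrame`. -/

theorem polarNorm_nonneg (x v : ℝ × ℝ) : 0 ≤ polarNorm x v := Real.sqrt_nonneg _

theorem flatNorm_nonneg (v : ℝ × ℝ) : 0 ≤ flatNorm v := Real.sqrt_nonneg _

theorem flatNorm_eq_polarNorm (v : ℝ × ℝ) : flatNorm v = polarNorm (1, 0) v := by
  simp [flatNorm, polarNorm]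

theorem polarNorm_mono {x y v : ℝ × ℝ} (hx : 0 ≤ x.1) (h : x.1 ≤ y.1) :
    polarNorm x v ≤ polarNorm y v := by
  unfold polarNorm
  gcongr

theorem polarNorm_le_add (x v : ℝ × ℝ) : polarNorm x v ≤ |v.1| + |x.1| * |v.2| := by
  unfold polarNorm
  rw [Real.sqrt_le_left (by positivity), add_sq, sq_abs, mul_pow, sq_abs, sq_abs]
  nlinarith [mul_nonneg (abs_nonneg v.1) (mul_nonneg (abs_nonneg x.1) (abs_nonneg v.2))]

/-- The norm of the image of `v` under a nearly diagonal map. -/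
theorem sqrt_le_of_nearly_diagonal {u w v₁ v₂ q t : ℝ} (hq : 0 ≤ q) (ht : 0 ≤ t)
    (hu : |u| ≤ q * |v₁|) (hw : |w| ≤ q * |v₂| + t * |v₁|) :
    √(u ^ 2 + w ^ 2) ≤ (q + t) * √(v₁ ^ 2 + v₂ ^ 2) := by
  rw [Real.sqrt_le_left (by positivity), mul_pow, Real.sq_sqrt (by positivity), ← sq_abs u,
    ← sq_abs w, ← sq_abs v₁, ← sq_abs v₂]
  have h1 : |u| ^ 2 ≤ (q * |v₁|) ^ 2 := by gcongr
  have h2 : |w| ^ 2 ≤ (q * |v₂| + t * |v₁|) ^ 2 := by gcongr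
  -- The slack is exactly `q t (|v₁| - |v₂|)² + q t |v₁|² + q t |v₂|² + t² |v₂|²`.
  nlinarith [mul_nonneg (mul_nonneg hq ht) (sq_nonneg (|v₁| - |v₂|)),
    mul_nonneg (mul_nonneg hq ht) (sq_nonneg |v₁|), mul_nonneg (mul_nonneg hq ht) (sq_nonneg |v₂|),
    mul_nonneg (sq_nonneg t) (sq_nonneg |v₂|)]

/-! ### Chains -/

section Chain

variable {α : Type} {arc : α → α → ℝ → Prop} {p q r : α} {L L' : ℝ}

theorem Chain.trans (h : Chain arc p q L) (h' : Chain arc q r L') : Chain arc p r (L + L') := by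
  induction h with
  | nil p => simpa using h'
  | cons a t ih => rw [add_assoc]; exact .cons a (ih h')

theorem Chain.single (h : arc p q L) : Chain arc p q L := by
  simpa using Chain.cons h (.nil q)

theorem Chain.nonneg (hnn : ∀ p q L, arc p q L → 0 ≤ L) (h : Chain arc p q L) : 0 ≤ L := by
  induction h with
  | nil p => exact le_rfl
  | cons a t ih => exact add_nonneg (hnn _ _ _ a) ih

theorem pathDist_le (hnn : ∀ p q L, arc p q L → 0 ≤ L) (h : Chain arc p q L) :
    pathDist arc p q ≤ L :=
  csInf_le ⟨0, fun _ hL => Chain.nonneg hnn hL⟩ h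

/-- A chain has to be supplied because `sInf ∅ = 0`; lower bounds on the distance therefore always
come with a proof of connectedness. -/
theorem le_pathDist {c : ℝ} (h : Chain arc p q L) (hc : ∀ L, Chain arc p q L → c ≤ L) :
    c ≤ pathDist arc p q :=
  le_csInf ⟨L, h⟩ hc

theorem pathDist_triangle (hnn : ∀ p q L, arc p q L → 0 ≤ L) (h : Chain arc p q L)
    (h' : Chain arc q r L') : pathDist arc p r ≤ pathDist arc p q + pathDist arc q r := by
  rw [← sub_le_iff_le_add]
  refine le_pathDist h fun l hl => ?_
  rw [sub_le_comm]
  refine le_pathDist h' fun l' hl' => ?_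
  rw [sub_le_iff_le_add']
  exact pathDist_le hnn (hl.trans hl')

end Chain

/-- A relation on an interval that is transitive for ordered points and holds between every point
and its neighbours holds between the end points. -/
theorem rel_of_local {R : ℝ → ℝ → Prop} {s t : ℝ} (hst : s ≤ t)
    (htrans : ∀ a b c, s ≤ a → a ≤ b → b ≤ c → c ≤ t → R a b → R b c → R a c)
    (hloc : ∀ x ∈ Icc s t, ∀ᶠ y in 𝓝[Icc s t] x, (y ≤ x → R y x) ∧ (x ≤ y → R x y)) :
    R s t := by
  have hself : ∀ x ∈ Icc s t, R x x := fun x hx =>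
    ((hloc x hx).self_of_nhdsWithin hx).1 le_rfl
  -- Continuous induction: the supremum of the points related to `s` is itself related to `s`, and
  -- it can be passed unless it equals `t`.
  set S : Set ℝ := {x | x ∈ Icc s t ∧ R s x} with hS
  have hs : s ∈ S := ⟨left_mem_Icc.2 hst, hself s (left_mem_Icc.2 hst)⟩
  have hbdd : BddAbove S := ⟨t, fun x hx => hx.1.2⟩
  set c := sSup S with hc
  have hcI : c ∈ Icc s t := ⟨le_csSup hbdd hs, csSup_le ⟨s, hs⟩ fun x hx => hx.1.2⟩
  have hev := hloc c hcI
  rw [eventually_nhdsWithin_iff, Metric.eventually_nhds_iff] at hev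
  obtain ⟨δ, hδ, hev⟩ := hev
  have hcS : R s c := by
    obtain ⟨x, hx, hxc⟩ := exists_lt_of_lt_csSup ⟨s, hs⟩ (sub_lt_self c hδ)
    have hx' : x ≤ c := le_csSup hbdd hx
    refine htrans s x c le_rfl hx.1.1 hx' hcI.2 hx.2 ((hev ?_ hx.1).1 hx')
    rw [Real.dist_eq, abs_lt]
    constructor <;> linarith
  rcases hcI.2.eq_or_lt with h | h
  · exact h ▸ hcS
  · exfalso
    have h1 : c < min t (c + δ / 2) := lt_min h (by linarith)
    have h2 : min t (c + δ / 2) ∈ Icc s t := ⟨hcI.1.trans h1.le, min_le_left _ _⟩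
    have h3 : R s (min t (c + δ / 2)) := by
      refine htrans s c _ le_rfl hcI.1 h1.le h2.2 hcS ((hev ?_ h2).2 h1.le)
      rw [Real.dist_eq, abs_lt]
      have := min_le_right t (c + δ / 2)
      constructor <;> linarith
    exact absurd (le_csSup hbdd ⟨h2, h3⟩) (not_le.2 h1)

/-! ### Arcs -/

theorem continuous_polarNorm_const {γ : ℝ → ℝ × ℝ} (hγ : ContDiff ℝ 1 γ) (x : ℝ × ℝ) :
    Continuous fun τ => polarNorm x (deriv γ τ) := by
  have := hγ.continuous_deriv le_rfl
  unfold polarNorm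
  fun_prop

theorem continuous_polarNorm {γ : ℝ → ℝ × ℝ} (hγ : ContDiff ℝ 1 γ) :
    Continuous fun τ => polarNorm (γ τ) (deriv γ τ) := by
  have := hγ.continuous_deriv le_rfl
  have := hγ.continuous
  unfold polarNorm
  fun_prop

theorem IsArc.nonneg {S : Set (ℝ × ℝ)} {nrm : ℝ × ℝ → ℝ × ℝ → ℝ} (hn : ∀ x v, 0 ≤ nrm x v)
    {x y : ℝ × ℝ} {L : ℝ} (h : IsArc S nrm x y L) : 0 ≤ L := by
  obtain ⟨γ, s, t, hst, -, -, -, -, rfl⟩ := h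
  exact intervalIntegral.integral_nonneg hst fun _ _ => hn _ _

theorem isArc_segment {S : Set (ℝ × ℝ)} (nrm : ℝ × ℝ → ℝ × ℝ → ℝ) {x y : ℝ × ℝ}
    (h : ∀ τ ∈ Icc (0 : ℝ) 1, x + τ • (y - x) ∈ S) :
    IsArc S nrm x y (∫ τ in (0 : ℝ)..1, nrm (x + τ • (y - x)) (y - x)) := by
  refine ⟨fun τ => x + τ • (y - x), 0, 1, zero_le_one, by fun_prop, h, by simp, by simp, ?_⟩
  congr 1
  ext τ
  have : HasDerivAt (fun τ : ℝ => x + τ • (y - x)) (y - x) τ := by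
    simpa using ((hasDerivAt_id τ).smul_const (y - x)).const_add x
  rw [this.deriv]

/-- In the flat metric `dX² + ρ² dY²` segments are shortest. -/
theorem polarNorm_sub_le_integral {γ : ℝ → ℝ × ℝ} (hγ : ContDiff ℝ 1 γ) (x : ℝ × ℝ) {s t : ℝ}
    (hst : s ≤ t) : polarNorm x (γ t - γ s) ≤ ∫ τ in s..t, polarNorm x (deriv γ τ) := by
  -- `ℝ × ℝ` carries the sup norm, so the vector is moved to `ℂ`, where the norm of an integral is
  -- at most the integral of the norm.
  have key : ∀ v : ℝ × ℝ, polarNorm x v = ‖((v.1 : ℂ) + ((x.1 * v.2 : ℝ) : ℂ) * Complex.I)‖ := by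
    intro v
    rw [Complex.norm_add_mul_I, polarNorm, mul_pow]
  have hd : ∀ τ, HasDerivAt (fun τ => ((γ τ).1 : ℂ) + ((x.1 * (γ τ).2 : ℝ) : ℂ) * Complex.I)
      (((deriv γ τ).1 : ℂ) + ((x.1 * (deriv γ τ).2 : ℝ) : ℂ) * Complex.I) τ := by
    intro τ
    have h0 : HasDerivAt γ (deriv γ τ) τ :=
      (hγ.differentiable one_ne_zero τ).hasDerivAt
    have h1 : HasDerivAt (fun τ => (γ τ).1) (deriv γ τ).1 τ := by
      simpa using h0.hasFDerivAt.fst.hasDerivAt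
    have h2 : HasDerivAt (fun τ => (γ τ).2) (deriv γ τ).2 τ := by
      simpa using h0.hasFDerivAt.snd.hasDerivAt
    exact h1.ofReal_comp.add ((h2.const_mul x.1).ofReal_comp.mul_const Complex.I)
  have hc := hγ.continuous_deriv le_rfl
  have hint := intervalIntegral.integral_eq_sub_of_hasDerivAt (a := s) (b := t)
    (fun τ _ => hd τ) (Continuous.intervalIntegrable (by fun_prop) _ _)
  have e : polarNorm x (γ t - γ s) =
      ‖∫ τ in s..t, (((deriv γ τ).1 : ℂ) + ((x.1 * (deriv γ τ).2 : ℝ) : ℂ) * Complex.I)‖ := by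
    rw [hint, key]
    congr 1
    push_cast [Prod.fst_sub, Prod.snd_sub]
    ring
  rw [e]
  simp_rw [key]
  exact intervalIntegral.norm_integral_le_integral_norm hst

theorem flatNorm_sub_le_of_isArc {S : Set (ℝ × ℝ)} {x y : ℝ × ℝ} {L : ℝ}
    (h : IsArc S (fun _ v => flatNorm v) x y L) : flatNorm (y - x) ≤ L := by
  obtain ⟨γ, s, t, hst, hγ, -, rfl, rfl, rfl⟩ := h
  simp_rw [flatNorm_eq_polarNorm]
  exact polarNorm_sub_le_integral hγ _ hst

theorem isArc_flat_segment {S : Set (ℝ × ℝ)} {x y : ℝ × ℝ}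
    (h : ∀ τ ∈ Icc (0 : ℝ) 1, x + τ • (y - x) ∈ S) :
    IsArc S (fun _ v => flatNorm v) x y (flatNorm (y - x)) := by
  simpa using isArc_segment (fun _ v => flatNorm v) h

namespace Params

variable {P : Params} {n : ℕ+}

/-! ### The sector -/

theorem R₀_pos (P : Params) : 0 < P.R₀ := div_pos (mul_pos P.a_pos P.b_pos) P.ε_pos

theorem sector_pos {x : ℝ × ℝ} (hx : x ∈ P.sector) : 0 < x.1 := (R₀_pos P).trans_le hx.1.1

theorem convex_sector : Convex ℝ P.sector := (convex_Icc _ _).prod (convex_Icc _ _)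

theorem sectorArc_nonneg (p q : P.sector) (L : ℝ)
    (h : IsArc P.sector polarNorm p q L) : 0 ≤ L :=
  h.nonneg polarNorm_nonneg

theorem surfaceArc_nonneg (p q : P.Surface n) (L : ℝ) (h : P.surfaceArc n p q L) : 0 ≤ L := by
  obtain ⟨_, _, _, _, _, h⟩ := h
  exact h.nonneg fun _ _ => flatNorm_nonneg _

/-- The coordinate segment joins two points of the sector. -/
theorem exists_sectorChain (x y : P.sector) {R : ℝ} (hx : x.1.1 ≤ R) (hy : y.1.1 ≤ R) :
    ∃ L, Chain (fun p q : P.sector => IsArc P.sector polarNorm p q) x y L ∧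
      L ≤ polarNorm (R, 0) (y.1 - x.1) := by
  have hS : ∀ τ ∈ Icc (0 : ℝ) 1, x.1 + τ • (y.1 - x.1) ∈ P.sector := fun τ hτ =>
    convex_sector.add_smul_sub_mem x.2 y.2 hτ
  refine ⟨_, Chain.single (isArc_segment polarNorm hS), ?_⟩
  have : ∫ _ in (0 : ℝ)..1, polarNorm (R, 0) (y.1 - x.1) = polarNorm (R, 0) (y.1 - x.1) := by
    simp
  rw [← this]
  refine intervalIntegral.integral_mono_on zero_le_one
    (Continuous.intervalIntegrable (by unfold polarNorm; fun_prop) _ _) (by simp)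
    fun τ hτ => polarNorm_mono (sector_pos (hS τ hτ)).le ?_
  have h1 := mul_le_mul_of_nonneg_left hx (sub_nonneg.2 hτ.2)
  have h2 := mul_le_mul_of_nonneg_left hy hτ.1
  simp
  nlinarith

theorem sectorDist_le (x y : P.sector) {R : ℝ} (hx : x.1.1 ≤ R) (hy : y.1.1 ≤ R) :
    P.sectorDist x y ≤ polarNorm (R, 0) (y.1 - x.1) := by
  obtain ⟨L, hL, h⟩ := exists_sectorChain x y hx hy
  exact (pathDist_le sectorArc_nonneg hL).trans h

theorem sectorDist_triangle (x y z : P.sector) :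
    P.sectorDist x z ≤ P.sectorDist x y + P.sectorDist y z := by
  obtain ⟨L, hL, -⟩ := exists_sectorChain x y x.2.1.2 y.2.1.2
  obtain ⟨L', hL', -⟩ := exists_sectorChain y z y.2.1.2 z.2.1.2
  exact pathDist_triangle sectorArc_nonneg hL hL'

theorem sectorDist_le_of_fst_eq (x y : P.sector) (h : x.1.1 = y.1.1) :
    P.sectorDist x y ≤ P.R₁ * |y.1.2 - x.1.2| := by
  refine (sectorDist_le x y x.2.1.2 y.2.1.2).trans ((polarNorm_le_add _ _).trans ?_)
  have : 0 ≤ P.R₁ := (sector_pos x.2).le.trans x.2.1.2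
  simp [h, abs_of_nonneg this]

/-- A bound for the diameter of the sector. -/
def diamBound (P : Params) : ℝ := P.b + P.R₁ * (P.ε / P.b)

theorem R₁_pos (P : Params) : 0 < P.R₁ := add_pos (R₀_pos P) P.b_pos

theorem diamBound_nonneg (P : Params) : 0 ≤ P.diamBound :=
  add_nonneg P.b_pos.le (mul_nonneg (R₁_pos P).le (div_pos P.ε_pos P.b_pos).le)

theorem sectorDist_le_diamBound (x y : P.sector) : P.sectorDist x y ≤ P.diamBound := by
  refine (sectorDist_le x y x.2.1.2 y.2.1.2).trans ((polarNorm_le_add _ _).trans ?_)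
  rw [abs_of_nonneg (R₁_pos P).le]
  have h1 := x.2.1
  have h2 := y.2.1
  have h3 := x.2.2
  have h4 := y.2.2
  rw [mem_Icc] at h1 h2 h3 h4
  unfold R₁ at h1 h2
  refine add_le_add (abs_le.2 ?_) (mul_le_mul_of_nonneg_left (abs_le.2 ?_) (R₁_pos P).le) <;>
    simp only [Prod.fst_sub, Prod.snd_sub] <;> constructor <;> linarith

/-! ### Constants of the cells -/

theorem tan_pos (P : Params) : 0 < Real.tan P.θ :=
  Real.tan_pos_of_pos_of_lt_pi_div_two P.θ_pos P.θ_lt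

theorem D_pos : 0 < P.D n := div_pos dφ_pos (mul_pos two_pos (tan_pos P))

theorem rad_add_one (s : ℝ) : P.rad n (s + 1) = P.rad n s + P.bCell n := by
  unfold rad; ring

theorem rad_lower (i : ℕ) :
    P.rad n (i + 1 / 2 - P.D n / 2) = P.rad n i + (1 - P.D n) / 2 * P.bCell n := by
  unfold rad; ring

theorem rad_upper (i : ℕ) :
    P.rad n (i + 1 / 2 + P.D n / 2) = P.rad n i + (1 + P.D n) / 2 * P.bCell n := by
  unfold rad; ring

theorem R₀_le_rad (i : ℕ) : P.R₀ ≤ P.rad n i := by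
  have := bCell_pos (P := P) (n := n)
  unfold rad
  nlinarith [(Nat.cast_nonneg i : (0 : ℝ) ≤ i)]

theorem rad_pos (i : ℕ) : 0 < P.rad n i := (R₀_pos P).trans_le (R₀_le_rad i)

theorem n_mul_bCell : ((n : ℕ) : ℝ) * P.bCell n = P.b := by
  have := n_pos n
  simp only [bCell]; field_simp

theorem n_mul_dφ : ((n : ℕ) : ℝ) * P.dφ n = P.ε / P.b := by
  have := n_pos n
  have := P.b_pos
  simp only [dφ, bCell, εCell]; field_simp

theorem cast_add_one_le (i : Fin n) : ((i : ℕ) : ℝ) + 1 ≤ (n : ℕ) := by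
  exact_mod_cast i.2

theorem rad_le_R₁ (i : Fin n) : P.rad n ((i : ℕ) + 1) ≤ P.R₁ := by
  have := mul_le_mul_of_nonneg_right (cast_add_one_le i) (bCell_pos (P := P) (n := n)).le
  rw [n_mul_bCell] at this
  unfold rad R₁
  linarith

theorem ang_nonneg (j : Fin n) : 0 ≤ P.ang n (j : ℕ) :=
  mul_nonneg (Nat.cast_nonneg _) dφ_pos.le

theorem ang_add_one (s : ℝ) : P.ang n (s + 1) = P.ang n s + P.dφ n := by
  unfold ang; ring

theorem ang_add_half (s : ℝ) : P.ang n (s + 1 / 2) = P.ang n s + P.dφ n / 2 := by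
  unfold ang; ring

theorem ang_le (j : Fin n) : P.ang n (j : ℕ) + P.dφ n ≤ P.ε / P.b := by
  have := mul_le_mul_of_nonneg_right (cast_add_one_le j) (dφ_pos (P := P) (n := n)).le
  rw [n_mul_dφ] at this
  unfold ang
  linarith

/-- The shear of `F_n` at the broken line: it does not depend on `n`, which is the whole difficulty
for the distances. -/
theorem dφ_div_two_mul_inv_D : P.dφ n / 2 * (1 / P.D n) = Real.tan P.θ := by
  have := dφ_pos (P := P) (n := n)
  have := tan_pos P
  simp only [D]
  field_simp

theorem factor_of_le {i : ℕ} {r : ℝ} (h : r ≤ P.rad n (i + 1 / 2 - P.D n / 2)) :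
    P.factor n i r = P.rad n i := if_pos h

theorem factor_of_mem {i : ℕ} {r : ℝ} (h : r ∈ Icc (P.rad n (i + 1 / 2 - P.D n / 2))
    (P.rad n (i + 1 / 2 + P.D n / 2))) :
    P.factor n i r = P.rad n i + 1 / P.D n * (r - P.rad n (i + 1 / 2 - P.D n / 2)) := by
  unfold factor
  split_ifs with h1
  · rw [h1.antisymm h.1]; ring
  · rfl
  · exact absurd h.2 ‹_›

theorem factor_of_ge {i : ℕ} {r : ℝ} (h : P.rad n (i + 1 / 2 + P.D n / 2) ≤ r) :
    P.factor n i r = P.rad n i + P.bCell n := by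
  have hD := D_pos (P := P) (n := n)
  have hb := bCell_pos (P := P) (n := n)
  unfold factor
  split_ifs with h1 h2
  · rw [rad_lower] at h1
    rw [rad_upper] at h
    nlinarith
  · rw [h2.antisymm h, rad_lower, rad_upper]
    field_simp
    ring
  · exact rad_add_one _

theorem factor_le (i : ℕ) (r : ℝ) : P.factor n i r ≤ P.rad n i + P.bCell n := by
  have hD := D_pos (P := P) (n := n)
  have hb := bCell_pos (P := P) (n := n)
  rcases le_total r (P.rad n (i + 1 / 2 - P.D n / 2)) with h1 | h1
  · rw [factor_of_le h1]; linarith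
  rcases le_total r (P.rad n (i + 1 / 2 + P.D n / 2)) with h2 | h2
  · rw [factor_of_mem ⟨h1, h2⟩, add_le_add_iff_left, one_div_mul_eq_div, div_le_iff₀ hD]
    rw [rad_upper] at h2
    rw [rad_lower]
    linarith
  · exact (factor_of_ge h2).le

theorem le_factor (i : ℕ) (r : ℝ) : P.rad n i ≤ P.factor n i r := by
  have hD := D_pos (P := P) (n := n)
  have hb := bCell_pos (P := P) (n := n)
  rcases le_total r (P.rad n (i + 1 / 2 - P.D n / 2)) with h1 | h1
  · exact (factor_of_le h1).ge
  rcases le_total r (P.rad n (i + 1 / 2 + P.D n / 2)) with h2 | h2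
  · rw [factor_of_mem ⟨h1, h2⟩]
    have : 0 ≤ 1 / P.D n * (r - P.rad n (i + 1 / 2 - P.D n / 2)) :=
      mul_nonneg (by positivity) (by linarith)
    linarith
  · rw [factor_of_ge h2]; linarith

theorem height_eq (i : ℕ) (X : ℝ) :
    height (P.aCell n i) (P.bCell n) P.θ (P.εCell n) X =
      P.dφ n / 2 * P.factor n i (P.rad n i + X) := by
  rw [factor_eq, add_sub_cancel_left]

/-- The ratio `1 + b_n / R₀`, a bound for the quotient of two radii in the same cell. -/
def ratio (P : Params) (n : ℕ+) : ℝ := 1 + P.bCell n / P.R₀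

theorem one_le_ratio : 1 ≤ P.ratio n :=
  le_add_of_nonneg_right (div_pos bCell_pos (R₀_pos P)).le

theorem rad_add_bCell_le {i : ℕ} {r : ℝ} (h : P.rad n i ≤ r) :
    P.rad n i + P.bCell n ≤ P.ratio n * r := by
  have hb := bCell_pos (P := P) (n := n)
  have hR := R₀_pos P
  have : P.bCell n ≤ P.bCell n / P.R₀ * r := by
    rw [div_mul_eq_mul_div, le_div_iff₀ hR]
    exact mul_le_mul_of_nonneg_left ((R₀_le_rad i).trans h) hb.le
  unfold ratio
  linarith

theorem mem_hex {h : Label n} {x : ℝ × ℝ} : x ∈ P.hex n h ↔ 0 ≤ x.1 ∧ x.1 ≤ P.bCell n ∧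
    if h.2.2 then -(P.dφ n / 2 * P.factor n h.1 (P.rad n (h.1 : ℕ) + x.1)) ≤ x.2 ∧ x.2 ≤ 0
    else 0 ≤ x.2 ∧ x.2 ≤ P.dφ n / 2 * P.factor n h.1 (P.rad n (h.1 : ℕ) + x.1) := by
  simp only [hex, hexagon, mem_ofPred_eq, height_eq]

/-! ### A nearly distance-decreasing map from the surface to the sector -/

/-- The radius by which the ordinate is divided in `foldAngle`. -/
def slopeRad (P : Params) (n : ℕ+) (i : ℕ) (X : ℝ) : ℝ :=
  max (P.rad n i) (P.rad n i + (2 * X - P.bCell n))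

/-- The angle over the point `(X, Y)` of a lower hexagon, relative to the bottom side. -/
def foldAngle (P : Params) (n : ℕ+) (i : ℕ) (X Y : ℝ) : ℝ :=
  min (Y / P.slopeRad n i X) (P.dφ n / 2)

/-- The map from the hexagon with label `h` to the sector. -/
def chartG (P : Params) (n : ℕ+) (h : Label n) (x : ℝ × ℝ) : ℝ × ℝ :=
  (P.rad n (h.1 : ℕ) + x.1,
    if h.2.2 then P.ang n ((h.2.1 : ℕ) + 1) - P.foldAngle n h.1 x.1 (-x.2)
    else P.ang n (h.2.1 : ℕ) + P.foldAngle n h.1 x.1 x.2)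

theorem rad_le_slopeRad (i : ℕ) (X : ℝ) : P.rad n i ≤ P.slopeRad n i X := le_max_left _ _

theorem slopeRad_pos (i : ℕ) (X : ℝ) : 0 < P.slopeRad n i X :=
  (rad_pos i).trans_le (rad_le_slopeRad i X)

/-- The gentle ramp leaves `rad n i` only at the centre of the cell, where `factor` has already
climbed half-way; from there `factor` climbs with slope `1 / D ≥ 2` until it reaches the value that
the ramp attains only at the right edge. -/
theorem slopeRad_le_factor (hD : P.D n ≤ 1 / 2) {i : ℕ} {X : ℝ} (hX : X ≤ P.bCell n) :
    P.slopeRad n i X ≤ P.factor n i (P.rad n i + X) := by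
  have hDp := D_pos (P := P) (n := n)
  have hb := bCell_pos (P := P) (n := n)
  refine max_le (le_factor _ _) ?_
  rcases le_total (P.rad n i + X) (P.rad n (i + 1 / 2 - P.D n / 2)) with h1 | h1
  · rw [factor_of_le h1]
    rw [rad_lower] at h1
    nlinarith
  rcases le_total (P.rad n i + X) (P.rad n (i + 1 / 2 + P.D n / 2)) with h2 | h2
  · rw [factor_of_mem ⟨h1, h2⟩, add_le_add_iff_left, one_div_mul_eq_div, le_div_iff₀ hDp]
    rw [rad_lower] at h1 ⊢
    rw [rad_upper] at h2
    rcases le_total (2 * X - P.bCell n) 0 with h3 | h3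
    · nlinarith
    · nlinarith
  · rw [factor_of_ge h2]; linarith

theorem foldAngle_zero (i : ℕ) (X : ℝ) : P.foldAngle n i X 0 = 0 := by
  rw [foldAngle, zero_div, min_eq_left (half_pos dφ_pos).le]

theorem foldAngle_nonneg (i : ℕ) (X : ℝ) {Y : ℝ} (hY : 0 ≤ Y) : 0 ≤ P.foldAngle n i X Y :=
  le_min (div_nonneg hY (slopeRad_pos i X).le) (half_pos dφ_pos).le

theorem foldAngle_le (i : ℕ) (X Y : ℝ) : P.foldAngle n i X Y ≤ P.dφ n / 2 := min_le_right _ _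

/-- The whole broken line falls into the truncated range, so the lower and the upper formula agree
on it. The region between the graph of the ramp and the broken line is collapsed to the middle
angle. -/
theorem foldAngle_middle (hD : P.D n ≤ 1 / 2) {i : ℕ} {X : ℝ} (hX : X ≤ P.bCell n) :
    P.foldAngle n i X (P.dφ n / 2 * P.factor n i (P.rad n i + X)) = P.dφ n / 2 := by
  refine min_eq_right ?_
  rw [le_div_iff₀ (slopeRad_pos i X)]
  exact mul_le_mul_of_nonneg_left (slopeRad_le_factor hD hX) (half_pos dφ_pos).le

theorem chartG_mem {h : Label n} {x : ℝ × ℝ} (hx : x ∈ P.hex n h) :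
    P.chartG n h x ∈ P.sector := by
  obtain ⟨i, j, up⟩ := h
  rw [mem_hex] at hx
  obtain ⟨h0, h1, h2⟩ := hx
  have hi := rad_le_R₁ (P := P) i
  have hr := R₀_le_rad (P := P) (n := n) i
  have hj := ang_nonneg (P := P) j
  have hj' := ang_le (P := P) j
  have hd := dφ_pos (P := P) (n := n)
  rw [rad_add_one] at hi
  dsimp only at h2
  cases up
  · have := foldAngle_nonneg (P := P) (n := n) i x.1 (h2.1 : 0 ≤ x.2)
    have h3 := foldAngle_le (P := P) (n := n) i x.1 x.2
    refine ⟨⟨?_, ?_⟩, ?_, ?_⟩ <;> simp [chartG] <;> linarith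
  · have := foldAngle_nonneg (P := P) (n := n) i x.1 (neg_nonneg.2 (h2.2 : x.2 ≤ 0))
    have h3 := foldAngle_le (P := P) (n := n) i x.1 (-x.2)
    refine ⟨⟨?_, ?_⟩, ?_, ?_⟩ <;> simp [chartG, ang_add_one] <;> linarith

theorem chartG_glue (hD : P.D n ≤ 1 / 2) {x y : P.Pieces n} (h : P.Glue n x y) :
    P.chartG n x.1 x.2.1 = P.chartG n y.1 y.2.1 := by
  have hb := bCell_pos (P := P) (n := n)
  induction h with
  | mid i j X Y Y' hY hY' h h' =>
    have hX := (mem_hex.1 h).2.1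
    subst hY'
    rw [height_eq] at hY
    subst hY
    simp only [chartG, if_true, Bool.false_eq_true, if_false, neg_neg, foldAngle_middle hD hX,
      ang_add_one]
    congr 1
    ring
  | vert i j j' hj X h h' =>
    simp [chartG, hj, foldAngle_zero]
  | horiz i i' j hi up Y h h' =>
    -- The ramp gains exactly `b_n` over a cell, so it ends where the ramp of the next column
    -- begins.
    have h1 : P.slopeRad n i (P.bCell n) = P.slopeRad n i' 0 := by
      unfold slopeRad
      rw [hi, Nat.cast_add_one, rad_add_one, max_eq_right (by linarith), max_eq_left (by linarith)]
      ring
    have h2 : P.rad n (i' : ℕ) = P.rad n (i : ℕ) + P.bCell n := by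
      rw [hi, Nat.cast_add_one, rad_add_one]
    simp only [chartG, foldAngle, h1, h2, add_zero]

/-- The map from the surface to the sector. -/
def G (P : Params) (n : ℕ+) (hD : P.D n ≤ 1 / 2) : P.Surface n → P.sector :=
  Quot.lift (fun x => ⟨P.chartG n x.1 x.2.1, chartG_mem x.2.2⟩)
    fun _ _ h => Subtype.ext (chartG_glue hD h)

/-- Truncation does not increase differences. In the difference of the two quotients, changing the
numerator costs the ratio of two radii; changing the denominator is harmless because `slopeRad` is
2-Lipschitz in `X` and the ordinate is at most of order `dφ`. -/
theorem abs_foldAngle_sub_le {i : ℕ} {X X' Y Y' : ℝ} (hY : 0 ≤ Y)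
    (hY' : Y ≤ P.dφ n / 2 * (P.rad n i + P.bCell n)) :
    (P.rad n i + P.bCell n) * |P.foldAngle n i X Y - P.foldAngle n i X' Y'| ≤
      P.ratio n * |Y - Y'| + P.ratio n ^ 2 * P.dφ n * |X - X'| := by
  have hb := bCell_pos (P := P) (n := n)
  have hd := dφ_pos (P := P) (n := n)
  have hr := rad_pos (P := P) (n := n) i
  have hq := one_le_ratio (P := P) (n := n)
  have hR := rad_add_bCell_le (P := P) (n := n) (le_refl (P.rad n i))
  have hm := rad_le_slopeRad (P := P) (n := n) i X
  have hm' := rad_le_slopeRad (P := P) (n := n) i X'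
  have hmm : |P.slopeRad n i X' - P.slopeRad n i X| ≤ 2 * |X - X'| := by
    refine (abs_max_sub_max_le_max _ _ _ _).trans (max_le (by simp) ?_)
    rw [abs_sub_comm X X', ← abs_two (α := ℝ), ← abs_mul, abs_two]
    exact le_of_eq (congrArg _ (by ring))
  have hsub : |P.foldAngle n i X Y - P.foldAngle n i X' Y'| ≤
      |Y / P.slopeRad n i X - Y' / P.slopeRad n i X'| := by
    refine (abs_min_sub_min_le_max _ _ _ _).trans (max_le le_rfl ?_)
    simp
  generalize P.slopeRad n i X = m at *
  generalize P.slopeRad n i X' = m' at *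
  set r := P.rad n i
  set R := r + P.bCell n
  have hm0 : 0 < m := hr.trans_le hm
  have hm0' : 0 < m' := hr.trans_le hm'
  have hR0 : 0 < R := add_pos hr hb
  have e : Y / m - Y' / m' = (Y - Y') / m' + Y * (m' - m) / (m * m') := by
    field_simp
    ring
  have h1 : |Y / m - Y' / m'| ≤ |Y - Y'| / r + Y * (2 * |X - X'|) / (r * r) := by
    rw [e]
    refine (abs_add_le _ _).trans (add_le_add ?_ ?_)
    · rw [abs_div, abs_of_pos hm0']
      gcongr
    · rw [abs_div, abs_mul, abs_of_nonneg hY, abs_of_pos (mul_pos hm0 hm0')]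
      gcongr
  have hRr : R / r ≤ P.ratio n := by rwa [div_le_iff₀ hr]
  calc R * _ ≤ R * (|Y - Y'| / r + Y * (2 * |X - X'|) / (r * r)) :=
        mul_le_mul_of_nonneg_left (hsub.trans h1) hR0.le
    _ ≤ R * (|Y - Y'| / r + (P.dφ n / 2 * R) * (2 * |X - X'|) / (r * r)) := by gcongr
    _ = R / r * |Y - Y'| + (R / r) ^ 2 * P.dφ n * |X - X'| := by field_simp
    _ ≤ _ := by gcongr

/-- The Lipschitz constant of `G`. -/
def lipG (P : Params) (n : ℕ+) : ℝ := P.ratio n + P.ratio n ^ 2 * P.dφ n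

/-- Convexity of the hexagon is not needed: only the end points are mapped, and their images are
joined by a coordinate segment in the sector, measured at the outer radius of the cell. -/
theorem sectorDist_chartG_le {h : Label n} {x y : ℝ × ℝ} (hx : x ∈ P.hex n h)
    (hy : y ∈ P.hex n h) :
    P.sectorDist ⟨_, chartG_mem hx⟩ ⟨_, chartG_mem hy⟩ ≤ P.lipG n * flatNorm (y - x) := by
  obtain ⟨i, j, up⟩ := h
  have hx' := mem_hex.1 hx
  have hy' := mem_hex.1 hy
  have hd := dφ_pos (P := P) (n := n)
  have hq := one_le_ratio (P := P) (n := n)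
  have hR0 : 0 < P.rad n (i : ℕ) + P.bCell n := add_pos (rad_pos i) bCell_pos
  have hf := mul_le_mul_of_nonneg_left
    (factor_le (P := P) (n := n) i (P.rad n (i : ℕ) + x.1)) (half_pos hd).le
  refine (sectorDist_le (R := P.rad n (i : ℕ) + P.bCell n) _ _ (by simpa [chartG] using hx'.2.1)
    (by simpa [chartG] using hy'.2.1)).trans ?_
  have key : |(P.rad n (i : ℕ) + P.bCell n) *
      (P.chartG n (i, j, up) y - P.chartG n (i, j, up) x).2| ≤
      P.ratio n * |(y - x).2| + P.ratio n ^ 2 * P.dφ n * |(y - x).1| := by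
    rw [abs_mul, abs_of_pos hR0]
    cases up
    · simp only [Bool.false_eq_true, if_false] at hx'
      have := abs_foldAngle_sub_le (P := P) (n := n) (i := i) (X := x.1) (X' := y.1)
        (Y' := y.2) hx'.2.2.1 (hx'.2.2.2.trans hf)
      rw [abs_sub_comm, abs_sub_comm x.2, abs_sub_comm x.1] at this
      simpa [chartG] using this
    · simp only [if_true] at hx'
      have := abs_foldAngle_sub_le (P := P) (n := n) (i := i) (X := x.1) (X' := y.1)
        (Y := -x.2) (Y' := -y.2) (by linarith) (by linarith)
      rw [abs_sub_comm x.1, show -x.2 - -y.2 = y.2 - x.2 by ring] at this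
      simpa [chartG] using this
  have h1 : |(P.chartG n (i, j, up) y - P.chartG n (i, j, up) x).1| ≤
      P.ratio n * |(y - x).1| := by
    simpa [chartG] using le_mul_of_one_le_left (abs_nonneg (y.1 - x.1)) hq
  have := sqrt_le_of_nearly_diagonal (by linarith) (by positivity) h1 key
  rwa [mul_pow] at this

theorem sectorDist_G_le (hD : P.D n ≤ 1 / 2) {p q : P.Surface n} {L : ℝ}
    (h : Chain (P.surfaceArc n) p q L) :
    P.sectorDist (P.G n hD p) (P.G n hD q) ≤ P.lipG n * L := by
  have hd := dφ_pos (P := P) (n := n)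
  have hq := one_le_ratio (P := P) (n := n)
  have hl : 0 ≤ P.lipG n := by unfold lipG; positivity
  induction h with
  | nil p =>
    simpa using sectorDist_le_of_fst_eq (P.G n hD p) (P.G n hD p) rfl
  | @cons p q r l L a t ih =>
    obtain ⟨h, x, y, rfl, rfl, ha⟩ := a
    rw [mul_add]
    refine (sectorDist_triangle _ (P.G n hD (Quot.mk _ ⟨h, y⟩)) _).trans (add_le_add ?_ ih)
    exact (sectorDist_chartG_le x.2 y.2).trans
      (mul_le_mul_of_nonneg_left (flatNorm_sub_le_of_isArc ha) hl)

/-! ### Half-cells, and the lower bound for the surface distance -/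

/-- The closed half-cells of the sector. -/
def halfCell (P : Params) (n : ℕ+) (h : Label n) : Set (ℝ × ℝ) :=
  Icc (P.rad n (h.1 : ℕ)) (P.rad n ((h.1 : ℕ) + 1)) ×ˢ
    if h.2.2 then Icc (P.ang n ((h.2.1 : ℕ) + 1 / 2)) (P.ang n ((h.2.1 : ℕ) + 1))
    else Icc (P.ang n (h.2.1 : ℕ)) (P.ang n ((h.2.1 : ℕ) + 1 / 2))

theorem mem_halfCell_label {x : ℝ × ℝ} (hx : x ∈ P.sector) : x ∈ P.halfCell n (P.label n x) := by
  obtain ⟨⟨h1, h2⟩, h3, h4⟩ := hx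
  have hb := bCell_pos (P := P) (n := n)
  have hd := dφ_pos (P := P) (n := n)
  have hi := idx_bounds (n := n) (t := (x.1 - P.R₀) / P.bCell n)
    (div_nonneg (by linarith) hb.le) (by
      rw [div_le_iff₀ hb, n_mul_bCell]; unfold R₁ at h2; linarith)
  have hj := idx_bounds (n := n) (t := x.2 / P.dφ n) (div_nonneg h3 hd.le) (by
      rw [div_le_iff₀ hd, n_mul_dφ]; exact h4)
  rw [le_div_iff₀ hb, div_le_iff₀ hb] at hi
  rw [le_div_iff₀ hd, div_le_iff₀ hd] at hj
  refine ⟨⟨?_, ?_⟩, ?_⟩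
  · simp only [rad, label]; linarith
  · simp only [rad, label]; linarith
  · simp only [label]
    by_cases h : P.ang n ((idx n (x.2 / P.dφ n) : ℕ) + 1 / 2) < x.2
    · simp only [h, decide_true, if_true]
      exact ⟨h.le, hj.2⟩
    · simp only [h, decide_false, Bool.false_eq_true, if_false]
      exact ⟨hj.1, not_lt.1 h⟩

/-- The angle from which angles are measured in `chartF`. -/
def baseAngle (P : Params) (n : ℕ+) (h : Label n) : ℝ :=
  if h.2.2 then P.ang n ((h.2.1 : ℕ) + 1) else P.ang n (h.2.1 : ℕ)

theorem mem_halfCell {h : Label n} {x : ℝ × ℝ} : x ∈ P.halfCell n h ↔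
    (P.rad n (h.1 : ℕ) ≤ x.1 ∧ x.1 ≤ P.rad n (h.1 : ℕ) + P.bCell n) ∧
    if h.2.2 then -(P.dφ n / 2) ≤ x.2 - P.baseAngle n h ∧ x.2 - P.baseAngle n h ≤ 0
    else 0 ≤ x.2 - P.baseAngle n h ∧ x.2 - P.baseAngle n h ≤ P.dφ n / 2 := by
  obtain ⟨i, j, up⟩ := h
  cases up
  all_goals
    simp only [halfCell, baseAngle, rad_add_one, ang_add_half, ang_add_one, if_true, Set.mem_prod,
      mem_Icc, Bool.false_eq_true, if_false]
    refine and_congr_right fun _ => and_congr ?_ ?_ <;> constructor <;> intro <;> linarith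

theorem abs_sub_baseAngle_le {h : Label n} {x : ℝ × ℝ} (hx : x ∈ P.halfCell n h) :
    |x.2 - P.baseAngle n h| ≤ P.dφ n / 2 := by
  have hd := dφ_pos (P := P) (n := n)
  have := (mem_halfCell.1 hx).2
  rw [abs_le]
  split_ifs at this <;> constructor <;> linarith

theorem chartF_eq (h : Label n) (x : ℝ × ℝ) : P.chartF n h x =
    (x.1 - P.rad n (h.1 : ℕ), (x.2 - P.baseAngle n h) * P.factor n h.1 x.1) := rfl

theorem chartF_mem_hex {h : Label n} {x : ℝ × ℝ} (hx : x ∈ P.halfCell n h) :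
    P.chartF n h x ∈ P.hex n h := by
  have hf := factor_nonneg (P := P) (n := n) h.1 x.1
  obtain ⟨⟨h1, h2⟩, h3⟩ := mem_halfCell.1 hx
  rw [mem_hex, chartF_eq]
  simp only [add_sub_cancel]
  refine ⟨by linarith, by linarith, ?_⟩
  split_ifs at h3 ⊢
  · exact ⟨by nlinarith, mul_nonpos_of_nonpos_of_nonneg h3.2 hf⟩
  · exact ⟨mul_nonneg h3.1 hf, by nlinarith⟩

/-- `G` and `F` both respect the subdivision into half-cells, so the two angles lie in the same
interval of length `dφ / 2`; the cruder bound suffices. -/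
theorem abs_sub_G_F_le (hD : P.D n ≤ 1 / 2) (x : P.sector) :
    |x.1.2 - (P.G n hD (P.F n x)).1.2| ≤ P.dφ n := by
  have hx := mem_halfCell_label (n := n) x.2
  have hc := chartF_mem_hex hx
  have e : (P.G n hD (P.F n x)).1 = P.chartG n (P.label n x) (P.chartF n (P.label n x) x) := rfl
  rw [e]
  generalize P.label n (x : ℝ × ℝ) = h at *
  have hx' := (mem_halfCell.1 hx).2
  have hc' := (mem_hex.1 hc).2.2
  obtain ⟨i, j, up⟩ := h
  cases up
  · simp only [Bool.false_eq_true, if_false, baseAngle] at hx' hc'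
    have h1 := foldAngle_nonneg (P := P) (n := n) i (P.chartF n (i, j, false) x).1 hc'.1
    have h2 := foldAngle_le (P := P) (n := n) i (P.chartF n (i, j, false) x).1
      (P.chartF n (i, j, false) x).2
    simp only [chartG, Bool.false_eq_true, if_false]
    rw [abs_le]
    constructor <;> linarith
  · simp only [if_true, baseAngle] at hx' hc'
    have h1 := foldAngle_nonneg (P := P) (n := n) i (P.chartF n (i, j, true) x).1
      (neg_nonneg.2 hc'.2)
    have h2 := foldAngle_le (P := P) (n := n) i (P.chartF n (i, j, true) x).1
      (-(P.chartF n (i, j, true) x).2)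
    simp only [chartG, if_true]
    rw [abs_le]
    constructor <;> linarith

/-- The lower bound for the distance of the surface. -/
theorem sectorDist_le_surfaceDist (hD : P.D n ≤ 1 / 2) (x y : P.sector) {L : ℝ}
    (h : Chain (P.surfaceArc n) (P.F n x) (P.F n y) L) :
    P.sectorDist x y ≤ P.lipG n * P.surfaceDist n (P.F n x) (P.F n y) +
      2 * (P.R₁ * P.dφ n) := by
  have hd := dφ_pos (P := P) (n := n)
  have hq := one_le_ratio (P := P) (n := n)
  have hl : 0 < P.lipG n := by unfold lipG; positivity
  have hG : P.sectorDist (P.G n hD (P.F n x)) (P.G n hD (P.F n y)) ≤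
      P.lipG n * P.surfaceDist n (P.F n x) (P.F n y) := by
    -- Dividing by the Lipschitz constant makes the left side a bound for every chain, hence for the
    -- infimum.
    rw [← div_le_iff₀' hl]
    refine le_pathDist h fun L hL => ?_
    rw [div_le_iff₀' hl]
    exact sectorDist_G_le hD hL
  have hfst : (P.G n hD (P.F n x)).1.1 = x.1.1 := add_sub_cancel _ _
  have hfst' : (P.G n hD (P.F n y)).1.1 = y.1.1 := add_sub_cancel _ _
  have h1 := sectorDist_triangle x (P.G n hD (P.F n x)) y
  have h2 := sectorDist_triangle (P.G n hD (P.F n x)) (P.G n hD (P.F n y)) y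
  have h3 := (sectorDist_le_of_fst_eq _ _ hfst.symm).trans
    (mul_le_mul_of_nonneg_left (abs_sub_comm x.1.2 _ ▸ abs_sub_G_F_le hD x) (R₁_pos P).le)
  have h4 := (sectorDist_le_of_fst_eq _ _ hfst').trans
    (mul_le_mul_of_nonneg_left (abs_sub_G_F_le hD y) (R₁_pos P).le)
  linarith

/-! ### Independence of the label -/

/-- The point of the surface over a point of a half-cell. -/
def point (P : Params) (n : ℕ+) (h : Label n) {z : ℝ × ℝ} (hz : z ∈ P.halfCell n h) :
    P.Surface n :=
  Quot.mk _ ⟨h, ⟨P.chartF n h z, chartF_mem_hex hz⟩⟩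

theorem le_of_rad_lt {i i' : ℕ} (h : P.rad n i < P.rad n i' + P.bCell n) : i ≤ i' := by
  have hb := bCell_pos (P := P) (n := n)
  rw [← rad_add_one] at h
  unfold rad at h
  have := lt_of_mul_lt_mul_right (lt_of_add_lt_add_left h) hb.le
  exact Nat.lt_succ_iff.1 (by exact_mod_cast this)

theorem le_of_ang_lt {j j' : ℕ} (h : P.ang n j < P.ang n j' + P.dφ n) : j ≤ j' := by
  have hd := dφ_pos (P := P) (n := n)
  rw [← ang_add_one] at h
  unfold ang at h
  have := lt_of_mul_lt_mul_right h hd.le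
  exact Nat.lt_succ_iff.1 (by exact_mod_cast this)

theorem mk_eq_of_horiz {i i' j : Fin n} (hi : (i' : ℕ) = i + 1) {up : Bool} {x x' : ℝ × ℝ}
    (hx : x ∈ P.hex n (i, j, up)) (hx' : x' ∈ P.hex n (i', j, up)) (h1 : x.1 = P.bCell n)
    (h2 : x'.1 = 0) (h3 : x'.2 = x.2) :
    (Quot.mk _ ⟨_, ⟨x, hx⟩⟩ : P.Surface n) = Quot.mk _ ⟨_, ⟨x', hx'⟩⟩ := by
  obtain ⟨X, Y⟩ := x
  obtain ⟨X', Y'⟩ := x'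
  dsimp only at h1 h2 h3
  subst h1 h2 h3
  exact Quot.sound (.horiz i i' j hi up _ hx hx')

theorem mk_eq_of_vert {i j j' : Fin n} (hj : (j' : ℕ) = j + 1) {x x' : ℝ × ℝ}
    (hx : x ∈ P.hex n (i, j, true)) (hx' : x' ∈ P.hex n (i, j', false)) (h1 : x.2 = 0)
    (h2 : x'.2 = 0) (h3 : x'.1 = x.1) :
    (Quot.mk _ ⟨_, ⟨x, hx⟩⟩ : P.Surface n) = Quot.mk _ ⟨_, ⟨x', hx'⟩⟩ := by
  obtain ⟨X, Y⟩ := x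
  obtain ⟨X', Y'⟩ := x'
  dsimp only at h1 h2 h3
  subst h1 h2 h3
  exact Quot.sound (.vert i j j' hj _ hx hx')

theorem mk_eq_of_mid {i j : Fin n} {x x' : ℝ × ℝ}
    (hx : x ∈ P.hex n (i, j, false)) (hx' : x' ∈ P.hex n (i, j, true))
    (h1 : x.2 = P.dφ n / 2 * P.factor n i (P.rad n (i : ℕ) + x.1)) (h2 : x'.2 = -x.2)
    (h3 : x'.1 = x.1) :
    (Quot.mk _ ⟨_, ⟨x, hx⟩⟩ : P.Surface n) = Quot.mk _ ⟨_, ⟨x', hx'⟩⟩ := by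
  obtain ⟨X, Y⟩ := x
  obtain ⟨X', Y'⟩ := x'
  dsimp only at h1 h2 h3
  subst h3
  exact Quot.sound (.mid i j _ _ _ (h1.trans (height_eq _ _).symm) h2 hx hx')

/-- Distinct columns containing the same radius are neighbours, and the point lies on their common
edge. There `factor` takes the outer value of one column and the inner value of the next, which
coincide, so the ordinates match. -/
theorem point_eq_of_column (hD : P.D n ≤ 1 / 2) {i i' j : Fin n} {up : Bool} {z : ℝ × ℝ}
    (h : z ∈ P.halfCell n (i, j, up)) (h' : z ∈ P.halfCell n (i', j, up)) :
    P.point n _ h = P.point n _ h' := by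
  have hb := bCell_pos (P := P) (n := n)
  wlog hle : (i : ℕ) ≤ i' generalizing i i'
  · exact (this h' h (le_of_not_ge hle)).symm
  have h1 := (mem_halfCell.1 h).1
  have h2 := (mem_halfCell.1 h').1
  dsimp only at h1 h2
  rcases hle.eq_or_lt with e | hlt
  · obtain rfl : i = i' := Fin.ext e
    rfl
  have hi : (i' : ℕ) = i + 1 := by
    refine le_antisymm (le_of_rad_lt (P := P) (n := n) ?_) hlt
    rw [Nat.cast_add_one, rad_add_one]
    linarith
  have hz : z.1 = P.rad n (i : ℕ) + P.bCell n := by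
    rw [hi, Nat.cast_add_one, rad_add_one] at h2
    exact le_antisymm h1.2 h2.1
  have hz' : z.1 = P.rad n (i' : ℕ) := by rw [hz, hi, Nat.cast_add_one, rad_add_one]
  -- Since `D ≤ 1`, the right edge lies beyond the middle zone; the same reason puts the left edge
  -- of the next column before it.
  have hf : P.factor n i z.1 = P.rad n (i : ℕ) + P.bCell n :=
    factor_of_ge (by rw [rad_upper, hz]; nlinarith)
  have hf' : P.factor n i' z.1 = P.rad n (i' : ℕ) :=
    factor_of_le (by rw [rad_lower, ← hz']; nlinarith)
  refine mk_eq_of_horiz hi _ _ ?_ ?_ ?_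
  · simp [chartF_eq, hz]
  · simp [chartF_eq, hz']
  · simp only [chartF_eq, baseAngle, hf, hf', ← hz, ← hz']

/-- A lower and an upper half-cell of one column meet either at the middle angle of a row, which is
sent to the broken line, or at the angle between two rows, where both ordinates vanish. -/
theorem point_eq_of_row {i j j' : Fin n} {up up' : Bool} {z : ℝ × ℝ}
    (h : z ∈ P.halfCell n (i, j, up)) (h' : z ∈ P.halfCell n (i, j', up')) :
    P.point n _ h = P.point n _ h' := by
  have hd := dφ_pos (P := P) (n := n)
  have main : ∀ {j j' : Fin n} (h : z ∈ P.halfCell n (i, j, false))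
      (h' : z ∈ P.halfCell n (i, j', true)), P.point n _ h = P.point n _ h' := by
    intro j j' h h'
    have h1 := (mem_halfCell.1 h).2
    have h2 := (mem_halfCell.1 h').2
    simp only [Bool.false_eq_true, if_false, if_true, baseAngle, ang_add_one] at h1 h2
    have hle : (j' : ℕ) ≤ j := le_of_ang_lt (P := P) (n := n) (by linarith)
    rcases hle.eq_or_lt with e | hlt
    · obtain rfl : j' = j := Fin.ext e
      have hz : z.2 = P.ang n (j' : ℕ) + P.dφ n / 2 := by linarith
      refine mk_eq_of_mid _ _ ?_ ?_ rfl <;>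
        simp [chartF_eq, baseAngle, ang_add_one, hz]
      ring
    · have hj : (j : ℕ) = j' + 1 := by
        refine le_antisymm (le_of_ang_lt (P := P) (n := n) ?_) hlt
        rw [Nat.cast_add_one, ang_add_one]
        linarith
      have hz : z.2 = P.ang n (j : ℕ) := by
        rw [hj, Nat.cast_add_one, ang_add_one] at h1 ⊢
        linarith
      refine (mk_eq_of_vert hj (chartF_mem_hex h') (chartF_mem_hex h) ?_ ?_ rfl).symm
      · simp [chartF_eq, baseAngle, hz, hj]
      · simp [chartF_eq, baseAngle, hz]
  have h1 := (mem_halfCell.1 h).2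
  have h2 := (mem_halfCell.1 h').2
  cases up <;> cases up' <;>
    simp only [Bool.false_eq_true, if_false, if_true, baseAngle, ang_add_one] at h1 h2
  · obtain rfl : j = j' := Fin.ext (le_antisymm (le_of_ang_lt (P := P) (n := n) (by linarith))
      (le_of_ang_lt (P := P) (n := n) (by linarith)))
    rfl
  · exact main h h'
  · exact (main h' h).symm
  · obtain rfl : j = j' := Fin.ext (le_antisymm (le_of_ang_lt (P := P) (n := n) (by linarith))
      (le_of_ang_lt (P := P) (n := n) (by linarith)))
    rfl

theorem point_eq (hD : P.D n ≤ 1 / 2) {h h' : Label n} {z z' : ℝ × ℝ} (hz : z ∈ P.halfCell n h)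
    (hz' : z' ∈ P.halfCell n h') (e : z = z') : P.point n h hz = P.point n h' hz' := by
  subst e
  obtain ⟨i, j, up⟩ := h
  obtain ⟨i', j', up'⟩ := h'
  -- Half-cells are products, so the radius of one label can be combined with the angle of the
  -- other.
  have hm : z ∈ P.halfCell n (i', j, up) := ⟨hz'.1, hz.2⟩
  exact (point_eq_of_column hD hz hm).trans (point_eq_of_row hm hz')

/-! ### The stretched map -/

/-- The stretching factor in the middle zone. -/
def root (P : Params) (n : ℕ+) : ℝ := √(P.D n)

theorem root_pos : 0 < P.root n := Real.sqrt_pos.2 D_pos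

theorem root_sq : P.root n * P.root n = P.D n := Real.mul_self_sqrt D_pos.le

theorem root_lt_one (hD : P.D n ≤ 1 / 2) : P.root n < 1 := by
  rw [← root_sq] at hD
  nlinarith

/-- The piecewise linear homeomorphism of `[0, 1]` that maps the interval of length `e` around
`1/2` onto the interval of length `e²` around `1/2`. -/
def stretch (e s : ℝ) : ℝ :=
  if s ≤ (1 - e) / 2 then (1 + e) * s
  else if s ≤ (1 + e) / 2 then (1 - e) / 2 + e * s
  else -e + (1 + e) * s

/-- The three intervals of linearity of `stretch e`. -/
def zone (e : ℝ) : Fin 3 → Set ℝ :=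
  ![Iic ((1 - e) / 2), Icc ((1 - e) / 2) ((1 + e) / 2), Ici ((1 + e) / 2)]

theorem stretch_of_le {e s : ℝ} (h : s ≤ (1 - e) / 2) : stretch e s = (1 + e) * s := if_pos h

theorem stretch_of_mem {e s : ℝ} (h : s ∈ Icc ((1 - e) / 2) ((1 + e) / 2)) :
    stretch e s = (1 - e) / 2 + e * s := by
  unfold stretch
  split_ifs with h1
  · rw [h1.antisymm h.1]; ring
  · rfl
  · exact absurd h.2 ‹_›

theorem stretch_of_ge {e s : ℝ} (he : 0 < e) (h : (1 + e) / 2 ≤ s) :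
    stretch e s = -e + (1 + e) * s := by
  unfold stretch
  split_ifs with h1 h2
  · linarith
  · rw [h2.antisymm h]; ring
  · rfl

theorem exists_mem_zone (e s : ℝ) : ∃ k, s ∈ zone e k := by
  rcases le_total s ((1 - e) / 2) with h | h
  · exact ⟨0, h⟩
  rcases le_total s ((1 + e) / 2) with h' | h'
  · exact ⟨1, h, h'⟩
  · exact ⟨2, h'⟩

theorem isClosed_zone (e : ℝ) (k : Fin 3) : IsClosed (zone e k) := by
  fin_cases k
  exacts [isClosed_Iic, isClosed_Icc, isClosed_Ici]

theorem stretch_mem {e s : ℝ} (he : 0 < e) (he' : e < 1) (hs : s ∈ Icc (0 : ℝ) 1) :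
    stretch e s ∈ Icc (0 : ℝ) 1 := by
  obtain ⟨h0, h1⟩ := hs
  unfold stretch
  split_ifs <;> constructor <;> nlinarith

theorem stretch_zero {e : ℝ} (he' : e < 1) : stretch e 0 = 0 := by
  rw [stretch_of_le (by linarith), mul_zero]

theorem stretch_one {e : ℝ} (he : 0 < e) (he' : e < 1) : stretch e 1 = 1 := by
  rw [stretch_of_ge he (by linarith)]; ring

/-- The stretching of the cells in the radial direction. -/
def stretchRad (P : Params) (n : ℕ+) (i : ℕ) (r : ℝ) : ℝ :=
  P.rad n i + P.bCell n * stretch (P.root n) ((r - P.rad n i) / P.bCell n)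

/-- The stretching of the half-cells in the radial direction. -/
def stretchPt (P : Params) (n : ℕ+) (h : Label n) (x : ℝ × ℝ) : ℝ × ℝ :=
  (P.stretchRad n h.1 x.1, x.2)

theorem stretchPt_mem (hD : P.D n ≤ 1 / 2) {h : Label n} {x : ℝ × ℝ}
    (hx : x ∈ P.halfCell n h) : P.stretchPt n h x ∈ P.halfCell n h := by
  have hb := bCell_pos (P := P) (n := n)
  rw [mem_halfCell] at hx ⊢
  refine ⟨?_, hx.2⟩
  have := stretch_mem root_pos (root_lt_one hD)
    (s := (x.1 - P.rad n (h.1 : ℕ)) / P.bCell n)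
    ⟨div_nonneg (by linarith) hb.le, by rw [div_le_iff₀ hb]; linarith⟩
  have h1 := mul_le_mul_of_nonneg_left this.1 hb.le
  have h2 := mul_le_mul_of_nonneg_left this.2 hb.le
  simp only [stretchPt, stretchRad]
  constructor <;> linarith

theorem stretchPt_eq (hD : P.D n ≤ 1 / 2) {h h' : Label n} {x : ℝ × ℝ}
    (hx : x ∈ P.halfCell n h) (hx' : x ∈ P.halfCell n h') :
    P.stretchPt n h x = P.stretchPt n h' x := by
  have hb := bCell_pos (P := P) (n := n)
  wlog hle : (h.1 : ℕ) ≤ h'.1 generalizing h h'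
  · exact (this hx' hx (le_of_not_ge hle)).symm
  have h1 := (mem_halfCell.1 hx).1
  have h2 := (mem_halfCell.1 hx').1
  rcases hle.eq_or_lt with e | hlt
  · simp only [stretchPt, e]
  have hi : (h'.1 : ℕ) = h.1 + 1 := by
    refine le_antisymm (le_of_rad_lt (P := P) (n := n) ?_) hlt
    rw [Nat.cast_add_one, rad_add_one]
    linarith
  have hr : P.rad n (h'.1 : ℕ) = P.rad n (h.1 : ℕ) + P.bCell n := by
    rw [hi, Nat.cast_add_one, rad_add_one]
  have hz : x.1 = P.rad n (h.1 : ℕ) + P.bCell n := by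
    rw [hr] at h2
    exact le_antisymm h1.2 h2.1
  simp only [stretchPt, stretchRad, hr, hz, sub_self, zero_div, add_sub_cancel_left,
    div_self hb.ne', stretch_zero (root_lt_one hD), stretch_one root_pos (root_lt_one hD)]
  rw [mul_one, mul_zero, add_zero]

/-- The map `F_n` precomposed with the stretching of the cells. -/
def stretchedF (P : Params) (n : ℕ+) (hD : P.D n ≤ 1 / 2) (x : P.sector) : P.Surface n :=
  P.point n _ (stretchPt_mem hD (mem_halfCell_label x.2))

theorem stretchedF_eq (hD : P.D n ≤ 1 / 2) (x : P.sector) {h : Label n}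
    (hx : x.1 ∈ P.halfCell n h) :
    P.stretchedF n hD x = P.point n h (stretchPt_mem hD hx) :=
  point_eq hD _ _ (stretchPt_eq hD (mem_halfCell_label x.2) hx)

/-- On every zone both the stretching and `factor` are affine. -/
theorem exists_affine (hD : P.D n ≤ 1 / 2) (i : ℕ) (k : Fin 3) :
    ∃ (σ c A B : ℝ) (J : Set ℝ), J.OrdConnected ∧ 0 ≤ σ ∧ σ ≤ 1 + P.root n ∧ 0 ≤ B ∧
      P.dφ n / 2 * (B * σ) ≤ P.root n * Real.tan P.θ ∧
      (∀ s ∈ zone (P.root n) k, stretch (P.root n) s = c + σ * s ∧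
        P.rad n i + P.bCell n * stretch (P.root n) s ∈ J) ∧
      ∀ r ∈ J, P.factor n i r = A + B * r := by
  have hb := bCell_pos (P := P) (n := n)
  have he := root_pos (P := P) (n := n)
  have hee := root_sq (P := P) (n := n)
  have hDp := D_pos (P := P) (n := n)
  have ht := tan_pos P
  have hT := dφ_div_two_mul_inv_D (P := P) (n := n)
  have e1 := rad_lower (P := P) (n := n) i
  have e2 := rad_upper (P := P) (n := n) i
  set e := P.root n
  fin_cases k
  · refine ⟨1 + e, 0, P.rad n i, 0, Iic (P.rad n (i + 1 / 2 - P.D n / 2)), ordConnected_Iic,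
      by positivity, le_rfl, le_rfl, ?_, fun s hs => ⟨?_, ?_⟩, fun r hr => ?_⟩
    · rw [zero_mul, mul_zero]; positivity
    · rw [stretch_of_le hs, zero_add]
    · rw [stretch_of_le hs, mem_Iic, e1, add_le_add_iff_left, mul_comm]
      have hs' : s ≤ (1 - e) / 2 := hs
      refine mul_le_mul_of_nonneg_right ?_ hb.le
      nlinarith
    · rw [factor_of_le hr]; ring
  · refine ⟨e, (1 - e) / 2, P.rad n i - 1 / P.D n * P.rad n (i + 1 / 2 - P.D n / 2), 1 / P.D n,
      Icc (P.rad n (i + 1 / 2 - P.D n / 2)) (P.rad n (i + 1 / 2 + P.D n / 2)), ordConnected_Icc,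
      he.le, by linarith, by positivity, ?_, fun s hs => ⟨stretch_of_mem hs, ?_⟩, fun r hr => ?_⟩
    -- The point of the construction: slope `1 / D` of `factor` times slope `√D` of the stretching,
    -- times half the angle of a cell, is `√D tan θ`.
    · rw [← mul_assoc, hT, mul_comm]
    · have hs' : s ∈ Icc ((1 - e) / 2) ((1 + e) / 2) := hs
      rw [stretch_of_mem hs, mem_Icc, e1, e2, add_le_add_iff_left, add_le_add_iff_left,
        mul_comm (P.bCell n)]
      constructor <;> refine mul_le_mul_of_nonneg_right ?_ hb.le
      -- The edges `(1 ± e) / 2` of the zone are sent to `(1 ± e²) / 2 = (1 ± D) / 2`, the edges of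
      -- the bad zone.
      · nlinarith [hs'.1]
      · nlinarith [hs'.2]
    · rw [factor_of_mem hr]; ring
  · refine ⟨1 + e, -e, P.rad n i + P.bCell n, 0, Ici (P.rad n (i + 1 / 2 + P.D n / 2)),
      ordConnected_Ici,
      by positivity, le_rfl, le_rfl, ?_, fun s hs => ⟨stretch_of_ge he hs, ?_⟩, fun r hr => ?_⟩
    · rw [zero_mul, mul_zero]; positivity
    · have hs' : (1 + e) / 2 ≤ s := hs
      rw [stretch_of_ge he hs, mem_Ici, e2, add_le_add_iff_left, mul_comm (P.bCell n)]
      refine mul_le_mul_of_nonneg_right ?_ hb.le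
      nlinarith
    · rw [factor_of_ge hr]; ring

/-- A hexagon need not be convex, but its part over an interval of abscissas where `factor` is
affine is a convex polygon. -/
theorem segment_mem_hex {h : Label n} {x y : ℝ × ℝ} (hx : x ∈ P.hex n h) (hy : y ∈ P.hex n h)
    {A B : ℝ} {J : Set ℝ} (hJ : J.OrdConnected) (hxJ : P.rad n (h.1 : ℕ) + x.1 ∈ J)
    (hyJ : P.rad n (h.1 : ℕ) + y.1 ∈ J) (hf : ∀ r ∈ J, P.factor n h.1 r = A + B * r)
    {τ : ℝ} (hτ : τ ∈ Icc (0 : ℝ) 1) : x + τ • (y - x) ∈ P.hex n h := by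
  have hz : P.rad n (h.1 : ℕ) + (x + τ • (y - x)).1 ∈ J := by
    have := hJ.convex.add_smul_sub_mem hxJ hyJ hτ
    convert this using 1
    simp
    ring
  rw [mem_hex] at hx hy ⊢
  rw [hf _ hz]
  rw [hf _ hxJ] at hx
  rw [hf _ hyJ] at hy
  obtain ⟨h0, h1⟩ := hτ
  have comb : ∀ {u v : ℝ}, 0 ≤ u → 0 ≤ v → 0 ≤ (1 - τ) * u + τ * v := fun hu hv =>
    add_nonneg (mul_nonneg (sub_nonneg.2 h1) hu) (mul_nonneg h0 hv)
  obtain ⟨hx1, hx2, hx3⟩ := hx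
  obtain ⟨hy1, hy2, hy3⟩ := hy
  simp only [Prod.fst_add, Prod.snd_add, Prod.smul_fst, Prod.smul_snd, Prod.fst_sub, Prod.snd_sub,
    smul_eq_mul]
  refine ⟨?_, ?_, ?_⟩
  · linarith [comb hx1 hy1]
  · linarith [comb (sub_nonneg.2 hx2) (sub_nonneg.2 hy2)]
  · split_ifs at hx3 hy3 ⊢
    · constructor
      · linarith [comb (sub_nonneg.2 hx3.1) (sub_nonneg.2 hy3.1)]
      · linarith [comb (neg_nonneg.2 hx3.2) (neg_nonneg.2 hy3.2)]
    · constructor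
      · linarith [comb hx3.1 hy3.1]
      · linarith [comb (sub_nonneg.2 hx3.2) (sub_nonneg.2 hy3.2)]

/-- The local Lipschitz constant of the stretched map. -/
def lipF (P : Params) (n : ℕ+) : ℝ :=
  (1 + P.root n) * P.ratio n + P.root n * Real.tan P.θ

/-- The closed part of a half-cell where the stretched map is affine in the radius. -/
def subCell (P : Params) (n : ℕ+) (c : Label n × Fin 3) : Set (ℝ × ℝ) :=
  P.halfCell n c.1 ∩
    {x | (x.1 - P.rad n (c.1.1 : ℕ)) / P.bCell n ∈ zone (P.root n) c.2}

theorem isClosed_subCell (c : Label n × Fin 3) : IsClosed (P.subCell n c) := by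
  refine IsClosed.inter (isClosed_Icc.prod ?_)
    ((isClosed_zone _ _).preimage (by fun_prop))
  split_ifs <;> exact isClosed_Icc

theorem exists_mem_subCell {x : ℝ × ℝ} (hx : x ∈ P.sector) : ∃ c, x ∈ P.subCell n c := by
  obtain ⟨k, hk⟩ := exists_mem_zone (P.root n)
    ((x.1 - P.rad n ((P.label n x).1 : ℕ)) / P.bCell n)
  exact ⟨(P.label n x, k), mem_halfCell_label hx, hk⟩

/-- The stretched map shrinks distances, up to a factor close to `1`, in every subcell. -/
theorem exists_chain_stretchedF (hD : P.D n ≤ 1 / 2) (x y : P.sector) {c : Label n × Fin 3}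
    (hx : x.1 ∈ P.subCell n c) (hy : y.1 ∈ P.subCell n c) :
    ∃ L, Chain (P.surfaceArc n) (P.stretchedF n hD x) (P.stretchedF n hD y) L ∧
      ∀ r, P.rad n (c.1.1 : ℕ) ≤ r → L ≤ P.lipF n * polarNorm (r, 0) (y.1 - x.1) := by
  obtain ⟨h, k⟩ := c
  obtain ⟨hxh, hxk⟩ := hx
  obtain ⟨hyh, hyk⟩ := hy
  dsimp only at hxh hyh hxk hyk
  obtain ⟨σ, c, A, B, J, hJ, hσ0, hσ, hB, hBσ, hz, hf⟩ := exists_affine hD (h.1 : ℕ) k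
  obtain ⟨sx, jx⟩ := hz _ hxk
  obtain ⟨sy, jy⟩ := hz _ hyk
  have mx := chartF_mem_hex (stretchPt_mem hD hxh)
  have my := chartF_mem_hex (stretchPt_mem hD hyh)
  refine ⟨_, Chain.single ⟨h, ⟨_, mx⟩, ⟨_, my⟩, (stretchedF_eq hD x hxh).symm,
    (stretchedF_eq hD y hyh).symm, isArc_flat_segment fun τ hτ =>
      segment_mem_hex mx my hJ ?_ ?_ hf hτ⟩, fun r hr => ?_⟩
  · simpa [chartF_eq, stretchPt, stretchRad] using jx
  · simpa [chartF_eq, stretchPt, stretchRad] using jy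
  have hb := bCell_pos (P := P) (n := n)
  have hq := one_le_ratio (P := P) (n := n)
  have he := root_pos (P := P) (n := n)
  have hr0 := (rad_pos (P := P) (n := n) h.1).trans_le hr
  have ht := tan_pos P
  have e1 : P.stretchRad n h.1 y.1.1 - P.stretchRad n h.1 x.1.1 = σ * (y.1.1 - x.1.1) := by
    unfold stretchRad
    rw [sx, sy]
    field_simp
    ring
  have e2 : P.factor n h.1 (P.stretchRad n h.1 y.1.1) -
      P.factor n h.1 (P.stretchRad n h.1 x.1.1) = B * (σ * (y.1.1 - x.1.1)) := by
    rw [hf _ (show P.stretchRad n h.1 y.1.1 ∈ J from jy),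
      hf _ (show P.stretchRad n h.1 x.1.1 ∈ J from jx), ← e1]
    ring
  have hfy := factor_le (P := P) (n := n) h.1 (P.stretchRad n h.1 y.1.1)
  have hfy0 := factor_nonneg (P := P) (n := n) h.1 (P.stretchRad n h.1 y.1.1)
  have hbase := abs_sub_baseAngle_le hxh
  have h1 : |(P.chartF n h (P.stretchPt n h y.1) - P.chartF n h (P.stretchPt n h x.1)).1| ≤
      ((1 + P.root n) * P.ratio n) * |(y.1 - x.1).1| := by
    have : (P.chartF n h (P.stretchPt n h y.1) - P.chartF n h (P.stretchPt n h x.1)).1 =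
        σ * (y.1.1 - x.1.1) := by
      rw [← e1]; simp [chartF_eq, stretchPt]
    rw [this, abs_mul, abs_of_nonneg hσ0]
    refine mul_le_mul_of_nonneg_right ?_ (abs_nonneg _)
    nlinarith
  have h2 : |(P.chartF n h (P.stretchPt n h y.1) - P.chartF n h (P.stretchPt n h x.1)).2| ≤
      ((1 + P.root n) * P.ratio n) * |r * (y.1 - x.1).2| +
        P.root n * Real.tan P.θ * |(y.1 - x.1).1| := by
    -- Product rule for differences: the first term is the nearly isometric angular part, the second
    -- is the shear controlled by `hBσ`.
    have : (P.chartF n h (P.stretchPt n h y.1) - P.chartF n h (P.stretchPt n h x.1)).2 =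
        P.factor n h.1 (P.stretchRad n h.1 y.1.1) * (y.1 - x.1).2 +
          (x.1.2 - P.baseAngle n h) * (B * (σ * (y.1 - x.1).1)) := by
      rw [Prod.fst_sub, ← e2]; simp [chartF_eq, stretchPt]; ring
    rw [this]
    refine (abs_add_le _ _).trans (add_le_add ?_ ?_)
    · rw [abs_mul, abs_of_nonneg hfy0, abs_mul, abs_of_pos hr0, ← mul_assoc]
      refine mul_le_mul_of_nonneg_right ?_ (abs_nonneg _)
      refine (hfy.trans (rad_add_bCell_le hr)).trans (mul_le_mul_of_nonneg_right ?_ hr0.le)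
      nlinarith
    · rw [← mul_assoc B, abs_mul, abs_mul (B * σ), abs_of_nonneg (mul_nonneg hB hσ0), ← mul_assoc]
      refine mul_le_mul_of_nonneg_right ?_ (abs_nonneg _)
      exact (mul_le_mul_of_nonneg_right hbase (mul_nonneg hB hσ0)).trans hBσ
  have := sqrt_le_of_nearly_diagonal (by positivity) (by positivity) h1 h2
  rwa [mul_pow] at this

/-- There are finitely many subcells and they are closed, so those missing `x` also miss a
neighbourhood of `x`. -/
theorem eventually_common_subCell (x : ℝ × ℝ) :
    ∀ᶠ y in 𝓝 x, y ∈ P.sector → ∃ c, x ∈ P.subCell n c ∧ y ∈ P.subCell n c := by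
  have : ∀ᶠ y in 𝓝 x, ∀ c, y ∈ P.subCell n c → x ∈ P.subCell n c := by
    refine eventually_all.2 fun c => ?_
    by_cases hx : x ∈ P.subCell n c
    · exact .of_forall fun _ _ => hx
    · filter_upwards [(isClosed_subCell c).isOpen_compl.mem_nhds hx] with y hy hy'
      exact absurd hy' hy
  filter_upwards [this] with y hy hyS
  obtain ⟨c, hc⟩ := exists_mem_subCell (n := n) hyS
  exact ⟨c, hy c hc, hc⟩

/-! ### Transport of curves from the sector to the surface -/

/-- The radius is frozen at `ρ`, where segments are shortest; the factor `l` pays for the radius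
varying along the curve. -/
theorem polarNorm_le_mul_integral {γ : ℝ → ℝ × ℝ} (hγ : ContDiff ℝ 1 γ) {a b ρ l : ℝ}
    (hab : a ≤ b) (hρ : 0 ≤ ρ) (hl : 1 ≤ l) (h : ∀ u ∈ Icc a b, ρ ≤ l * (γ u).1) :
    polarNorm (ρ, 0) (γ b - γ a) ≤ l * ∫ u in a..b, polarNorm (γ u) (deriv γ u) := by
  refine (polarNorm_sub_le_integral hγ (ρ, 0) hab).trans ?_
  rw [← intervalIntegral.integral_const_mul]
  refine intervalIntegral.integral_mono_on hab
    ((continuous_polarNorm_const hγ _).intervalIntegrable _ _)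
    ((continuous_const.mul (continuous_polarNorm hγ)).intervalIntegrable _ _) fun u hu => ?_
  unfold polarNorm
  rw [Real.sqrt_le_left (by positivity), mul_pow, Real.sq_sqrt (by positivity)]
  have h1 : ρ ^ 2 ≤ (l * (γ u).1) ^ 2 := pow_le_pow_left₀ hρ (h u hu) 2
  have h2 := mul_le_mul_of_nonneg_right h1 (sq_nonneg (deriv γ u).2)
  have h3 : (1 : ℝ) ≤ l ^ 2 := one_le_pow₀ hl
  have h4 := mul_le_mul_of_nonneg_right h3 (sq_nonneg (deriv γ u).1)
  dsimp only
  linarith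

/-- A `C¹` arc may cross the edges of subcells infinitely often, so it is not cut at the crossings.
Every parameter has a neighbourhood whose points share a subcell with it and where the radius is
nearly constant; `rel_of_local` concatenates the resulting segments, and the integrals add up. -/
theorem exists_chain_of_sectorArc (hD : P.D n ≤ 1 / 2) {l : ℝ} (hl : 1 < l) {x y : P.sector}
    {L : ℝ} (h : IsArc P.sector polarNorm x y L) :
    ∃ L', Chain (P.surfaceArc n) (P.stretchedF n hD x) (P.stretchedF n hD y) L' ∧
      L' ≤ P.lipF n * l * L := by
  have hlip : 0 ≤ P.lipF n := by
    have := one_le_ratio (P := P) (n := n)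
    have := root_pos (P := P) (n := n)
    have := tan_pos P
    unfold lipF
    positivity
  obtain ⟨γ, s, t, hst, hγ, hS, hs, ht, rfl⟩ := h
  have hint : ∀ a b, IntervalIntegrable (fun u => polarNorm (γ u) (deriv γ u)) volume a b :=
    fun a b => (continuous_polarNorm hγ).intervalIntegrable _ _
  have key : ∃ (L' : ℝ) (h1 : γ s ∈ P.sector) (h2 : γ t ∈ P.sector),
      Chain (P.surfaceArc n) (P.stretchedF n hD ⟨_, h1⟩) (P.stretchedF n hD ⟨_, h2⟩) L' ∧
      L' ≤ P.lipF n * l * ∫ u in s..t, polarNorm (γ u) (deriv γ u) := by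
    refine rel_of_local (R := fun a b => ∃ (L' : ℝ) (h1 : γ a ∈ P.sector) (h2 : γ b ∈ P.sector),
      Chain (P.surfaceArc n) (P.stretchedF n hD ⟨_, h1⟩) (P.stretchedF n hD ⟨_, h2⟩) L' ∧
      L' ≤ P.lipF n * l * ∫ u in a..b, polarNorm (γ u) (deriv γ u)) hst ?_ ?_
    · rintro a b c - - - - ⟨L₁, ha, hb, hc₁, hL₁⟩ ⟨L₂, hb', hc, hc₂, hL₂⟩
      refine ⟨_, ha, hc, hc₁.trans hc₂, ?_⟩
      rw [← intervalIntegral.integral_add_adjacent_intervals (hint a b) (hint b c), mul_add]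
      exact add_le_add hL₁ hL₂
    · intro τ hτ
      have hpos := sector_pos (hS τ hτ)
      have hcont : Continuous fun u => (γ u).1 := continuous_fst.comp hγ.continuous
      have h1 : ∀ᶠ u in 𝓝 τ, (γ τ).1 < l * (γ u).1 :=
        (continuous_const.mul hcont).continuousAt.eventually_const_lt
          (lt_mul_of_one_lt_left hpos hl)
      obtain ⟨δ, hδ, h1⟩ := Metric.eventually_nhds_iff.1 h1
      have h2 := hγ.continuous.continuousAt.eventually
        (eventually_common_subCell (P := P) (n := n) (γ τ))
      filter_upwards [nhdsWithin_le_nhds h2, nhdsWithin_le_nhds (Metric.ball_mem_nhds τ hδ),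
        self_mem_nhdsWithin] with u hc hu huI
      obtain ⟨c, hcτ, hcu⟩ := hc (hS u huI)
      rw [Metric.mem_ball, Real.dist_eq, abs_lt] at hu
      have hrad := (mem_halfCell.1 hcτ.1).1.1
      constructor
      · intro hle
        obtain ⟨L', hch, hL'⟩ := exists_chain_stretchedF hD ⟨_, hS u huI⟩ ⟨_, hS τ hτ⟩ hcu hcτ
        refine ⟨L', hS u huI, hS τ hτ, hch, (hL' _ hrad).trans ?_⟩
        rw [mul_assoc]
        refine mul_le_mul_of_nonneg_left
          (polarNorm_le_mul_integral hγ hle hpos.le hl.le fun v hv => (h1 ?_).le) hlip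
        rw [Real.dist_eq, abs_lt]
        constructor <;> linarith [hv.1, hv.2]
      · intro hle
        obtain ⟨L', hch, hL'⟩ := exists_chain_stretchedF hD ⟨_, hS τ hτ⟩ ⟨_, hS u huI⟩ hcτ hcu
        refine ⟨L', hS τ hτ, hS u huI, hch, (hL' _ hrad).trans ?_⟩
        rw [mul_assoc]
        refine mul_le_mul_of_nonneg_left
          (polarNorm_le_mul_integral hγ hle hpos.le hl.le fun v hv => (h1 ?_).le) hlip
        rw [Real.dist_eq, abs_lt]
        constructor <;> linarith [hv.1, hv.2]
  obtain ⟨L', h1, h2, hch, hL'⟩ := key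
  obtain rfl : x = ⟨_, h1⟩ := Subtype.ext hs.symm
  obtain rfl : y = ⟨_, h2⟩ := Subtype.ext ht.symm
  exact ⟨L', hch, hL'⟩

theorem exists_chain_of_sectorChain (hD : P.D n ≤ 1 / 2) {l : ℝ} (hl : 1 < l) {x y : P.sector}
    {L : ℝ} (h : Chain (fun p q : P.sector => IsArc P.sector polarNorm p q) x y L) :
    ∃ L', Chain (P.surfaceArc n) (P.stretchedF n hD x) (P.stretchedF n hD y) L' ∧
      L' ≤ P.lipF n * l * L := by
  induction h with
  | nil p => exact ⟨0, .nil _, by simp⟩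
  | cons a t ih =>
    obtain ⟨L₁, h₁, hL₁⟩ := exists_chain_of_sectorArc hD hl a
    obtain ⟨L₂, h₂, hL₂⟩ := ih
    exact ⟨_, h₁.trans h₂, by rw [mul_add]; exact add_le_add hL₁ hL₂⟩

/-! ### Moving end points inside a hexagon, and the upper bound for the surface distance -/

/-- A bound for the intrinsic diameter of the hexagons. -/
def hexDiam (P : Params) (n : ℕ+) : ℝ := P.bCell n + P.dφ n * P.R₁

/-- Since the hexagon need not be convex, the chain goes vertically to the side `Y = 0`, along it,
and vertically to the other point. -/
theorem exists_chain_hex {h : Label n} (x y : P.hex n h) :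
    ∃ L, Chain (P.surfaceArc n) (Quot.mk _ ⟨h, x⟩) (Quot.mk _ ⟨h, y⟩) L ∧ L ≤ P.hexDiam n := by
  have hd := dφ_pos (P := P) (n := n)
  have hR : P.rad n (h.1 : ℕ) + P.bCell n ≤ P.R₁ := by
    rw [← rad_add_one]; exact rad_le_R₁ h.1
  have harc : ∀ {u v : ℝ × ℝ} (hu : u ∈ P.hex n h) (hv : v ∈ P.hex n h),
      (∀ τ ∈ Icc (0 : ℝ) 1, u + τ • (v - u) ∈ P.hex n h) →
      Chain (P.surfaceArc n) (Quot.mk _ ⟨h, ⟨u, hu⟩⟩) (Quot.mk _ ⟨h, ⟨v, hv⟩⟩)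
        (flatNorm (v - u)) := fun hu hv hS =>
    Chain.single ⟨h, ⟨_, hu⟩, ⟨_, hv⟩, rfl, rfl, isArc_flat_segment hS⟩
  have hbase : ∀ {X : ℝ}, 0 ≤ X → X ≤ P.bCell n → (X, (0 : ℝ)) ∈ P.hex n h := by
    intro X h0 h1
    have := mul_nonneg (half_pos hd).le (factor_nonneg (P := P) (n := n) h.1 (P.rad n (h.1 : ℕ) + X))
    rw [mem_hex]
    refine ⟨h0, h1, ?_⟩
    split_ifs <;> constructor <;> linarith
  have hvert : ∀ {u : ℝ × ℝ}, u ∈ P.hex n h → ∀ l ∈ Icc (0 : ℝ) 1, (u.1, l * u.2) ∈ P.hex n h := by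
    intro u hu l hl
    have := mul_nonneg (half_pos hd).le
      (factor_nonneg (P := P) (n := n) h.1 (P.rad n (h.1 : ℕ) + u.1))
    rw [mem_hex] at hu ⊢
    refine ⟨hu.1, hu.2.1, ?_⟩
    have h3 := hu.2.2
    split_ifs at h3 ⊢ <;> constructor <;> nlinarith [hl.1, hl.2]
  have hht : ∀ {u : ℝ × ℝ}, u ∈ P.hex n h → |u.2| ≤ P.dφ n / 2 * P.R₁ := by
    intro u hu
    have := mul_le_mul_of_nonneg_left ((factor_le (P := P) (n := n) h.1
      (P.rad n (h.1 : ℕ) + u.1)).trans hR) (half_pos hd).le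
    have h0 := mul_nonneg (half_pos hd).le (R₁_pos P).le
    have h3 := (mem_hex.1 hu).2.2
    rw [abs_le]
    split_ifs at h3 <;> constructor <;> linarith
  have hnorm : ∀ v : ℝ × ℝ, flatNorm v ≤ |v.1| + |v.2| := fun v => by
    simpa [flatNorm_eq_polarNorm] using polarNorm_le_add (1, 0) v
  obtain ⟨x, hx⟩ := x
  obtain ⟨y, hy⟩ := y
  have hx' := mem_hex.1 hx
  have hy' := mem_hex.1 hy
  have bx := hbase hx'.1 hx'.2.1
  have hby := hbase hy'.1 hy'.2.1
  refine ⟨_, ((harc hx bx fun τ hτ => ?_).trans (harc bx hby fun τ hτ => ?_)).trans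
    (harc hby hy fun τ hτ => ?_), ?_⟩
  · convert hvert hx (1 - τ) ⟨by linarith [hτ.2], by linarith [hτ.1]⟩ using 1
    ext <;> simp
    ring
  · have := (convex_Icc (0 : ℝ) (P.bCell n)).add_smul_sub_mem ⟨hx'.1, hx'.2.1⟩ ⟨hy'.1, hy'.2.1⟩ hτ
    convert hbase this.1 this.2 using 1
    ext <;> simp
  · convert hvert hy τ hτ using 1
    ext <;> simp
  · have h1 := hnorm ((x.1, (0 : ℝ)) - x)
    have h2 := hnorm ((y.1, (0 : ℝ)) - (x.1, (0 : ℝ)))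
    have h3 := hnorm (y - (y.1, (0 : ℝ)))
    have h4 : |y.1 - x.1| ≤ P.bCell n := by
      rw [abs_le]; constructor <;> linarith [hx'.1, hx'.2.1, hy'.1, hy'.2.1]
    have h5 := hht hx
    have h6 := hht hy
    simp only [Prod.fst_sub, Prod.snd_sub, sub_self, abs_zero, zero_add, add_zero, zero_sub,
      abs_neg, sub_zero] at h1 h2 h3
    unfold hexDiam
    linarith

/-- The upper bound for the distance of the surface. -/
theorem surfaceDist_le_sectorDist (hD : P.D n ≤ 1 / 2) {l : ℝ} (hl : 1 < l) (x y : P.sector) :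
    (∃ L, Chain (P.surfaceArc n) (P.F n x) (P.F n y) L) ∧
    P.surfaceDist n (P.F n x) (P.F n y) ≤
      P.lipF n * l * P.sectorDist x y + 2 * P.hexDiam n := by
  have hlip : 0 < P.lipF n := by
    have := one_le_ratio (P := P) (n := n)
    have := root_pos (P := P) (n := n)
    have := tan_pos P
    unfold lipF
    positivity
  have hK : 0 < P.lipF n * l := mul_pos hlip (by linarith)
  have hx := mem_halfCell_label (n := n) x.2
  have hy := mem_halfCell_label (n := n) y.2
  -- The stretching preserves half-cells, so the images under `F` and `stretchedF` lie in one
  -- hexagon.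
  obtain ⟨L₁, h₁, hL₁⟩ := exists_chain_hex ⟨_, chartF_mem_hex hx⟩
    ⟨_, chartF_mem_hex (stretchPt_mem hD hx)⟩
  obtain ⟨L₂, h₂, hL₂⟩ := exists_chain_hex ⟨_, chartF_mem_hex (stretchPt_mem hD hy)⟩
    ⟨_, chartF_mem_hex hy⟩
  have main : ∀ L, Chain (fun p q : P.sector => IsArc P.sector polarNorm p q) x y L →
      ∃ L', Chain (P.surfaceArc n) (P.F n x) (P.F n y) L' ∧
        L' ≤ P.lipF n * l * L + 2 * P.hexDiam n := by
    intro L hL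
    obtain ⟨L', hc, hL'⟩ := exists_chain_of_sectorChain hD hl hL
    exact ⟨_, (h₁.trans hc).trans h₂, by linarith⟩
  obtain ⟨L, hL, -⟩ := exists_sectorChain x y x.2.1.2 y.2.1.2
  refine ⟨(main L hL).imp fun _ h => h.1, ?_⟩
  rw [← sub_le_iff_le_add, ← div_le_iff₀' hK]
  refine le_pathDist hL fun L hL => ?_
  obtain ⟨L', hc, hL'⟩ := main L hL
  rw [div_le_iff₀' hK, sub_le_iff_le_add]
  exact (pathDist_le surfaceArc_nonneg hc).trans hL'

end Params

/-! ### The differential -/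

/-- The linear isometry `(v_r, v_φ) ↦ (v_r, r v_φ)`. -/
def polarFrame (r : ℝ) : ℝ × ℝ →L[ℝ] ℝ × ℝ :=
  (ContinuousLinearMap.fst ℝ ℝ ℝ).prod (r • ContinuousLinearMap.snd ℝ ℝ ℝ)

theorem polarFrame_mem_SO {x : ℝ × ℝ} (hx : 0 < x.1) : polarFrame x.1 ∈ SO x := by
  refine ⟨fun v => ?_, ?_⟩
  · simp [flatNorm, polarNorm, polarFrame, mul_pow]
  · have : (polarFrame x.1 : ℝ × ℝ →ₗ[ℝ] ℝ × ℝ) =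
        LinearMap.prodMap LinearMap.id (x.1 • LinearMap.id) := by
      ext <;> simp [polarFrame]
    rw [ContinuousLinearMap.det, this, LinearMap.det_prodMap]
    simpa using hx

theorem polarNorm_pos {x v : ℝ × ℝ} (hx : 0 < x.1) (hv : v ≠ 0) : 0 < polarNorm x v := by
  refine Real.sqrt_pos.2 ?_
  rcases eq_or_ne v.1 0 with h | h
  · have : v.2 ≠ 0 := fun h' => hv (Prod.ext h h')
    positivity
  · positivity

theorem opNorm_nonneg (x : ℝ × ℝ) (A : ℝ × ℝ →L[ℝ] ℝ × ℝ) : 0 ≤ opNorm x A := by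
  refine Real.sSup_nonneg ?_
  rintro _ ⟨v, -, rfl⟩
  exact div_nonneg (flatNorm_nonneg _) (polarNorm_nonneg _ _)

/-- Only the competitor `polarFrame` is used; no nearest isometry is needed. -/
theorem distSO_le {x : ℝ × ℝ} (hx : 0 < x.1) {A : ℝ × ℝ →L[ℝ] ℝ × ℝ} {c : ℝ} (hc : 0 ≤ c)
    (h : ∀ v, flatNorm (A v - polarFrame x.1 v) ≤ c * polarNorm x v) : distSO x A ≤ c := by
  have h1 : opNorm x (A - polarFrame x.1) ≤ c := by
    refine Real.sSup_le ?_ hc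
    rintro _ ⟨v, hv, rfl⟩
    rw [div_le_iff₀ (polarNorm_pos hx hv)]
    exact h v
  have hbdd : BddBelow {c | ∃ Q ∈ SO x, c = opNorm x (A - Q)} := by
    refine ⟨0, ?_⟩
    rintro _ ⟨Q, -, rfl⟩
    exact opNorm_nonneg _ _
  exact (csInf_le hbdd ⟨polarFrame x.1, polarFrame_mem_SO hx, rfl⟩).trans h1

namespace Params

variable {P : Params} {n : ℕ+}

theorem hasFDerivAt_chartF {h : Label n} {x : ℝ × ℝ} {f' : ℝ}
    (hf : HasDerivAt (P.factor n h.1) f' x.1) :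
    HasFDerivAt (P.chartF n h) ((ContinuousLinearMap.fst ℝ ℝ ℝ).prod
      ((x.2 - P.baseAngle n h) • (f' • ContinuousLinearMap.fst ℝ ℝ ℝ) +
        P.factor n h.1 x.1 • ContinuousLinearMap.snd ℝ ℝ ℝ)) x := by
  have h1 : HasFDerivAt (fun y : ℝ × ℝ => P.factor n h.1 y.1)
      (f' • ContinuousLinearMap.fst ℝ ℝ ℝ) x := hf.comp_hasFDerivAt x hasFDerivAt_fst
  have h2 : HasFDerivAt (fun y : ℝ × ℝ => y.2 - P.baseAngle n h)
      (ContinuousLinearMap.snd ℝ ℝ ℝ) x := hasFDerivAt_snd.sub_const _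
  exact (hasFDerivAt_fst.sub_const _).prodMk (h2.mul h1)

/-- The differential and `polarFrame` have the same first component. In the second they differ by
`factor - r`, at most the width of a cell, and by the shear, at most `dφ / 2` times the slope of
`factor`. -/
theorem distSO_fderiv_chartF_le {h : Label n} {x : ℝ × ℝ} (hx : x ∈ P.halfCell n h) {f' : ℝ}
    (hf0 : 0 ≤ f') (hf : HasDerivAt (P.factor n h.1) f' x.1) :
    distSO x (fderiv ℝ (P.chartF n h) x) ≤ P.bCell n / P.R₀ + P.dφ n / 2 * f' := by
  have hb := bCell_pos (P := P) (n := n)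
  have hd := dφ_pos (P := P) (n := n)
  have hR := R₀_pos P
  have hr := (mem_halfCell.1 hx).1
  have hRx : P.R₀ ≤ x.1 := (R₀_le_rad h.1).trans hr.1
  refine distSO_le (hR.trans_le hRx) (by positivity) fun v => ?_
  rw [(hasFDerivAt_chartF hf).fderiv]
  have e : ((ContinuousLinearMap.fst ℝ ℝ ℝ).prod
      ((x.2 - P.baseAngle n h) • (f' • ContinuousLinearMap.fst ℝ ℝ ℝ) +
        P.factor n h.1 x.1 • ContinuousLinearMap.snd ℝ ℝ ℝ)) v - polarFrame x.1 v =
      (0, (P.factor n h.1 x.1 - x.1) * v.2 + (x.2 - P.baseAngle n h) * f' * v.1) := by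
    ext <;> simp [polarFrame]
    ring
  rw [e]
  have h1 : |(P.factor n h.1 x.1 - x.1) * v.2 + (x.2 - P.baseAngle n h) * f' * v.1| ≤
      P.bCell n / P.R₀ * |x.1 * v.2| + P.dφ n / 2 * f' * |v.1| := by
    refine (abs_add_le _ _).trans (add_le_add ?_ ?_)
    · rw [abs_mul, abs_mul, abs_of_pos (hR.trans_le hRx), ← mul_assoc]
      refine mul_le_mul_of_nonneg_right ?_ (abs_nonneg _)
      have h2 : P.bCell n ≤ P.bCell n / P.R₀ * x.1 := by
        rw [div_mul_eq_mul_div, le_div_iff₀ hR]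
        exact mul_le_mul_of_nonneg_left hRx hb.le
      have h3 := le_factor (P := P) (n := n) h.1 x.1
      have h4 := factor_le (P := P) (n := n) h.1 x.1
      rw [abs_le]
      constructor <;> linarith
    · rw [abs_mul, abs_mul, abs_of_nonneg hf0]
      have := abs_sub_baseAngle_le hx
      gcongr
  have := sqrt_le_of_nearly_diagonal (u := 0) (v₁ := v.1) (by positivity) (by positivity)
    (by rw [abs_zero]; positivity) h1
  rwa [mul_pow] at this

/-- The union of the closed middle zones of the columns. -/
def strips (P : Params) (n : ℕ+) : Set (ℝ × ℝ) :=
  ⋃ i : Fin n, Prod.fst ⁻¹' Icc (P.rad n ((i : ℕ) + 1 / 2 - P.D n / 2))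
    (P.rad n ((i : ℕ) + 1 / 2 + P.D n / 2))

/-- The radii where the factors are not differentiable. -/
def stripEdges (P : Params) (n : ℕ+) : Set ℝ :=
  ⋃ i : Fin n, {P.rad n ((i : ℕ) + 1 / 2 - P.D n / 2), P.rad n ((i : ℕ) + 1 / 2 + P.D n / 2)}

theorem finite_stripEdges : (P.stripEdges n).Finite :=
  finite_iUnion fun _ => (finite_singleton _).insert _

theorem measurableSet_strips : MeasurableSet (P.strips n) :=
  MeasurableSet.iUnion fun _ => measurable_fst measurableSet_Icc

/-- Off the edges of the strips `factor` is locally affine, with slope `1 / D` in a strip and 0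
elsewhere. The label is frozen before differentiating and each chart is defined on the whole plane,
so boundaries of half-cells need no exclusion. -/
theorem distSO_dF_le {x : ℝ × ℝ} (hx : x ∈ P.sector) (he : x.1 ∉ P.stripEdges n) :
    distSO x (P.dF n x) ≤ P.bCell n / P.R₀ + (P.strips n).indicator (fun _ => Real.tan P.θ) x := by
  have hh := mem_halfCell_label (n := n) hx
  have hDp := D_pos (P := P) (n := n)
  have ht := tan_pos P
  have hind : 0 ≤ (P.strips n).indicator (fun _ => Real.tan P.θ) x :=
    indicator_nonneg (fun _ _ => ht.le) x
  unfold dF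
  generalize P.label n x = h at hh
  simp only [stripEdges, mem_iUnion, mem_insert_iff, mem_singleton_iff, not_exists, not_or] at he
  obtain ⟨hne₁, hne₂⟩ := he h.1
  rcases lt_or_gt_of_ne hne₁ with h1 | h1
  · have hf : HasDerivAt (P.factor n h.1) 0 x.1 := by
      refine (hasDerivAt_const x.1 (P.rad n (h.1 : ℕ))).congr_of_eventuallyEq ?_
      filter_upwards [Iio_mem_nhds h1] with r hr using factor_of_le (le_of_lt hr)
    have := distSO_fderiv_chartF_le hh le_rfl hf
    linarith
  rcases lt_or_gt_of_ne hne₂ with h2 | h2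
  · have hf : HasDerivAt (P.factor n h.1) (1 / P.D n) x.1 := by
      have : HasDerivAt (fun r => P.rad n (h.1 : ℕ) +
          1 / P.D n * (r - P.rad n ((h.1 : ℕ) + 1 / 2 - P.D n / 2))) (1 / P.D n) x.1 := by
        simpa using (((hasDerivAt_id x.1).sub_const
          (P.rad n ((h.1 : ℕ) + 1 / 2 - P.D n / 2))).const_mul (1 / P.D n)).const_add
            (P.rad n (h.1 : ℕ))
      refine this.congr_of_eventuallyEq ?_
      filter_upwards [Ioo_mem_nhds h1 h2] with r hr using factor_of_mem (Ioo_subset_Icc_self hr)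
    have := distSO_fderiv_chartF_le hh (by positivity) hf
    rw [dφ_div_two_mul_inv_D] at this
    have hs : x ∈ P.strips n := mem_iUnion.2 ⟨h.1, le_of_lt h1, le_of_lt h2⟩
    rwa [indicator_of_mem hs]
  · have hf : HasDerivAt (P.factor n h.1) 0 x.1 := by
      refine (hasDerivAt_const x.1 (P.rad n (h.1 : ℕ) + P.bCell n)).congr_of_eventuallyEq ?_
      filter_upwards [Ioi_mem_nhds h2] with r hr using factor_of_ge (le_of_lt hr)
    have := distSO_fderiv_chartF_le hh le_rfl hf
    linarith

/-! ### The measure of the strips -/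

theorem measurableSet_sector : MeasurableSet P.sector := measurableSet_Icc.prod measurableSet_Icc

theorem sectorVol_apply_le {T : Set (ℝ × ℝ)} (hT : MeasurableSet T) :
    P.sectorVol T ≤ ENNReal.ofReal P.R₁ * volume (T ∩ P.sector) := by
  unfold sectorVol
  rw [withDensity_apply _ hT, Measure.restrict_restrict hT, ← setLIntegral_const]
  exact setLIntegral_mono measurable_const fun x hx => ENNReal.ofReal_le_ofReal hx.2.1.2

theorem sectorVol_univ_ne_top : P.sectorVol univ ≠ ⊤ := by
  refine ((sectorVol_apply_le MeasurableSet.univ).trans_lt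
    (ENNReal.mul_lt_top ENNReal.ofReal_lt_top ?_)).ne
  rw [univ_inter]
  exact (isCompact_Icc.prod isCompact_Icc).measure_lt_top

/-- The `n` strips have width `D b_n` each, hence total width `D b`, and angular extent `ε / b`; the
density is at most `R₁`. -/
theorem sectorVol_strips_le :
    P.sectorVol (P.strips n) ≤ ENNReal.ofReal (P.R₁ * (P.D n * P.ε)) := by
  have hD := D_pos (P := P) (n := n)
  have hb := bCell_pos (P := P) (n := n)
  have hn := n_mul_bCell (P := P) (n := n)
  have hbb := P.b_pos
  refine (sectorVol_apply_le measurableSet_strips).trans ?_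
  rw [ENNReal.ofReal_mul (R₁_pos P).le]
  refine mul_le_mul_right ?_ _
  have hsub : P.strips n ∩ P.sector ⊆ ⋃ i : Fin n,
      Icc (P.rad n ((i : ℕ) + 1 / 2 - P.D n / 2)) (P.rad n ((i : ℕ) + 1 / 2 + P.D n / 2)) ×ˢ
        Icc 0 (P.ε / P.b) := by
    rintro x ⟨hx, hxS⟩
    obtain ⟨i, hi⟩ := mem_iUnion.1 hx
    exact mem_iUnion.2 ⟨i, hi, hxS.2⟩
  refine (measure_mono hsub).trans ((measure_iUnion_le _).trans ?_)
  have hvol : ∀ i : Fin n, volume (Icc (P.rad n ((i : ℕ) + 1 / 2 - P.D n / 2))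
      (P.rad n ((i : ℕ) + 1 / 2 + P.D n / 2)) ×ˢ Icc 0 (P.ε / P.b)) =
      ENNReal.ofReal (P.D n * P.bCell n * (P.ε / P.b)) := by
    intro i
    rw [Measure.volume_eq_prod, Measure.prod_prod, Real.volume_Icc, Real.volume_Icc, rad_lower,
      rad_upper, ← ENNReal.ofReal_mul (by nlinarith)]
    congr 1
    ring
  rw [tsum_congr hvol, tsum_fintype, Finset.sum_const, Finset.card_univ, Fintype.card_fin,
    ← ENNReal.ofReal_nsmul, nsmul_eq_mul]
  refine ENNReal.ofReal_le_ofReal (le_of_eq ?_)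
  rw [show ((n : ℕ) : ℝ) * (P.D n * P.bCell n * (P.ε / P.b)) =
    (n : ℕ) * P.bCell n * P.D n * (P.ε / P.b) by ring, hn]
  field_simp

theorem ae_sectorVol (P : Params) (n : ℕ+) :
    ∀ᵐ x ∂P.sectorVol, x ∈ P.sector ∧ x.1 ∉ P.stripEdges n := by
  refine (withDensity_absolutelyContinuous _ _).ae_le ?_
  refine (ae_restrict_mem measurableSet_sector).and (ae_restrict_of_ae ?_)
  have h0 : ∀ᵐ r : ℝ, r ∉ P.stripEdges n := finite_stripEdges.countable.ae_notMem _
  exact Measure.quasiMeasurePreserving_fst.ae h0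

/-- Off the strips the integrand is uniformly small; on them it is only bounded, but their volume is
of order `D`. -/
theorem lintegral_distSO_le {p : ℝ} (hp : 1 ≤ p) :
    ∫⁻ x, ENNReal.ofReal (distSO x (P.dF n x)) ^ p ∂P.sectorVol ≤
      ENNReal.ofReal (P.bCell n / P.R₀) ^ p * P.sectorVol univ +
      ENNReal.ofReal (P.bCell n / P.R₀ + Real.tan P.θ) ^ p *
        ENNReal.ofReal (P.R₁ * (P.D n * P.ε)) := by
  have hp0 : 0 ≤ p := zero_le_one.trans hp
  calc _ ≤ ∫⁻ x, (ENNReal.ofReal (P.bCell n / P.R₀) ^ p + (P.strips n).indicator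
          (fun _ => ENNReal.ofReal (P.bCell n / P.R₀ + Real.tan P.θ) ^ p) x) ∂P.sectorVol := by
        refine lintegral_mono_ae ?_
        filter_upwards [ae_sectorVol P n] with x hx
        have h := ENNReal.rpow_le_rpow (ENNReal.ofReal_le_ofReal (distSO_dF_le hx.1 hx.2)) hp0
        by_cases hs : x ∈ P.strips n
        · rw [indicator_of_mem hs] at h ⊢
          exact h.trans le_add_self
        · rw [indicator_of_notMem hs, add_zero] at h ⊢
          exact h
    _ = ENNReal.ofReal (P.bCell n / P.R₀) ^ p * P.sectorVol univ +
        ENNReal.ofReal (P.bCell n / P.R₀ + Real.tan P.θ) ^ p * P.sectorVol (P.strips n) := by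
        rw [lintegral_add_left measurable_const, lintegral_const,
          lintegral_indicator_const measurableSet_strips]
    _ ≤ _ := by
        gcongr
        exact sectorVol_strips_le

/-! ### Limits -/

theorem tendsto_bCell (P : Params) : Tendsto (fun n : ℕ+ => P.bCell n) atTop (𝓝 0) :=
  (tendsto_const_div_atTop_nhds_zero_nat P.b).comp tendsto_PNat_val_atTop_atTop

theorem tendsto_dφ (P : Params) : Tendsto (fun n : ℕ+ => P.dφ n) atTop (𝓝 0) := by
  refine ((tendsto_const_div_atTop_nhds_zero_nat (P.ε / P.b)).comp
    tendsto_PNat_val_atTop_atTop).congr fun n => ?_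
  have := n_pos n
  rw [← n_mul_dφ (P := P) (n := n)]
  simp only [Function.comp_apply]
  field_simp

theorem tendsto_D (P : Params) : Tendsto (fun n : ℕ+ => P.D n) atTop (𝓝 0) := by
  simpa [D] using (tendsto_dφ P).div_const (2 * Real.tan P.θ)

theorem tendsto_root (P : Params) : Tendsto (fun n : ℕ+ => P.root n) atTop (𝓝 0) := by
  simpa [root] using (tendsto_D P).sqrt

theorem tendsto_ratio (P : Params) : Tendsto (fun n : ℕ+ => P.ratio n) atTop (𝓝 1) := by
  simpa [ratio] using ((tendsto_bCell P).div_const P.R₀).const_add 1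

theorem tendsto_lipF (P : Params) : Tendsto (fun n : ℕ+ => P.lipF n) atTop (𝓝 1) := by
  simpa [lipF] using (((tendsto_root P).const_add 1).mul (tendsto_ratio P)).add
    ((tendsto_root P).mul_const (Real.tan P.θ))

theorem tendsto_lipG (P : Params) : Tendsto (fun n : ℕ+ => P.lipG n) atTop (𝓝 1) := by
  simpa [lipG] using (tendsto_ratio P).add (((tendsto_ratio P).pow 2).mul (tendsto_dφ P))

theorem tendsto_hexDiam (P : Params) : Tendsto (fun n : ℕ+ => P.hexDiam n) atTop (𝓝 0) := by
  simpa [hexDiam] using (tendsto_bCell P).add ((tendsto_dφ P).mul_const P.R₁)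

theorem one_le_lipF : 1 ≤ P.lipF n := by
  have := one_le_ratio (P := P) (n := n)
  have := root_pos (P := P) (n := n)
  have := mul_pos this (tan_pos P)
  unfold lipF
  nlinarith

theorem one_le_lipG : 1 ≤ P.lipG n := by
  have := one_le_ratio (P := P) (n := n)
  have := dφ_pos (P := P) (n := n)
  have : 0 ≤ P.ratio n ^ 2 * P.dφ n := by positivity
  unfold lipG
  linarith

/-! ### Conclusion for the distortion -/

/-- The two Lipschitz estimates are multiplicative; bounded diameters make them additive. The errors
of both directions are nonnegative, so their sum bounds the absolute value. -/
theorem distortion_le (hD : P.D n ≤ 1 / 2) {l : ℝ} (hl : 1 < l) :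
    P.distortion n ≤ ENNReal.ofReal
      (((P.lipF n * l - 1) * P.diamBound + 2 * P.hexDiam n) +
        ((P.lipG n - 1) * (P.lipF n * l * P.diamBound + 2 * P.hexDiam n) +
          2 * (P.R₁ * P.dφ n))) := by
  refine iSup₂_le fun x y => ENNReal.ofReal_le_ofReal ?_
  obtain ⟨⟨L, hL⟩, h1⟩ := surfaceDist_le_sectorDist hD hl x y
  have h2 := sectorDist_le_surfaceDist hD x y hL
  have h3 := sectorDist_le_diamBound x y
  have hF := one_le_lipF (P := P) (n := n)
  have hG := one_le_lipG (P := P) (n := n)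
  have hK : 1 ≤ P.lipF n * l := one_le_mul_of_one_le_of_one_le hF hl.le
  have hdiam := diamBound_nonneg P
  have hh : 0 ≤ P.hexDiam n := add_nonneg bCell_pos.le (mul_nonneg dφ_pos.le (R₁_pos P).le)
  have hd : 0 ≤ P.R₁ * P.dφ n := mul_nonneg (R₁_pos P).le dφ_pos.le
  have h4 : P.surfaceDist n (P.F n x) (P.F n y) ≤
      P.lipF n * l * P.diamBound + 2 * P.hexDiam n :=
    h1.trans (add_le_add (mul_le_mul_of_nonneg_left h3 (by linarith)) le_rfl)
  have h5 := mul_le_mul_of_nonneg_left h3 (sub_nonneg.2 hK)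
  have h6 := mul_le_mul_of_nonneg_left h4 (sub_nonneg.2 hG)
  have h7 : 0 ≤ (P.lipF n * l - 1) * P.diamBound := mul_nonneg (sub_nonneg.2 hK) hdiam
  have h8 : 0 ≤ (P.lipG n - 1) * (P.lipF n * l * P.diamBound + 2 * P.hexDiam n) :=
    mul_nonneg (sub_nonneg.2 hG) (add_nonneg (mul_nonneg (by linarith) hdiam) (by linarith))
  rw [abs_le]
  constructor <;> linarith

theorem tendsto_distortion (P : Params) :
    Tendsto (fun n : ℕ+ => P.distortion n) atTop (𝓝 0) := by
  -- Any `l > 1` is admissible for each `n`; `1 + 1 / n` lets it tend to 1 together with the other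
  -- constants.
  have hl : Tendsto (fun n : ℕ+ => 1 + 1 / ((n : ℕ) : ℝ)) atTop (𝓝 1) := by
    simpa using ((tendsto_const_div_atTop_nhds_zero_nat (1 : ℝ)).comp
      tendsto_PNat_val_atTop_atTop).const_add 1
  have hK := (tendsto_lipF P).mul hl
  have hlim := ((((hK.sub_const 1).mul_const P.diamBound).add
    ((tendsto_hexDiam P).const_mul 2)).add
      (((tendsto_lipG P).sub_const 1).mul ((hK.mul_const P.diamBound).add
        ((tendsto_hexDiam P).const_mul 2)) |>.add
          (((tendsto_dφ P).const_mul P.R₁).const_mul 2)))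
  have hlim' := ENNReal.tendsto_ofReal hlim
  simp only [mul_one, sub_self, zero_mul, mul_zero, add_zero, ENNReal.ofReal_zero] at hlim'
  refine tendsto_of_tendsto_of_tendsto_of_le_of_le' tendsto_const_nhds hlim'
    (.of_forall fun _ => zero_le) ?_
  -- The construction only needs `D < 1`, that is, a dislocation line that fits into its block; the
  -- stronger bound is what the ramp of slope 2 requires.
  filter_upwards [(tendsto_D P).eventually_le_const (by norm_num : (0 : ℝ) < 1 / 2)] with n hD
  exact distortion_le hD (lt_add_of_pos_right 1 (one_div_pos.2 (n_pos n)))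

theorem tendsto_lintegral_distSO (P : Params) {p : ℝ} (hp : 1 ≤ p) :
    Tendsto (fun n : ℕ+ => ∫⁻ x, ENNReal.ofReal (distSO x (P.dF n x)) ^ p ∂P.sectorVol)
      atTop (𝓝 0) := by
  have hp0 : 0 < p := zero_lt_one.trans_le hp
  have hb := (tendsto_bCell P).div_const P.R₀
  rw [zero_div] at hb
  have h1 := (ENNReal.tendsto_ofReal hb).ennrpow_const p
  rw [ENNReal.ofReal_zero, ENNReal.zero_rpow_of_pos hp0] at h1
  have h1' := ENNReal.Tendsto.mul_const h1 (Or.inr (sectorVol_univ_ne_top (P := P)))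
  have h2 := (ENNReal.tendsto_ofReal (hb.add_const (Real.tan P.θ))).ennrpow_const p
  have h3 := ENNReal.tendsto_ofReal (((tendsto_D P).mul_const P.ε).const_mul P.R₁)
  have h4 := ENNReal.Tendsto.mul h2 (Or.inr ENNReal.ofReal_ne_top) h3
    (Or.inr (ENNReal.rpow_ne_top_of_nonneg hp0.le ENNReal.ofReal_ne_top))
  have h5 := h1'.add h4
  simp only [zero_mul, mul_zero, ENNReal.ofReal_zero, add_zero] at h5
  exact tendsto_of_tendsto_of_tendsto_of_le_of_le tendsto_const_nhds h5 (fun _ => zero_le)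
    fun n => lintegral_distSO_le hp

end Params

end EdgeDislocation

end

theorem proposition3p1 (P : EdgeDislocation.Params) :
    Tendsto (fun n : ℕ+ => P.distortion n) atTop (𝓝 0) ∧
    ∀ p : ℝ, 1 ≤ p →
      Tendsto
        (fun n : ℕ+ =>
          ∫⁻ x, ENNReal.ofReal (EdgeDislocation.distSO x (P.dF n x)) ^ p ∂P.sectorVol)
        atTop (𝓝 0) := by
  exact ⟨EdgeDislocation.Params.tendsto_distortion P, fun _ hp =>
    EdgeDislocation.Params.tendsto_lintegral_distSO P hp⟩
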